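/- Let $0<\alpha_1<1$, $\alpha_1+\alpha_2=1$, $\sigma_1,\sigma_2>0$ with $\sigma_1^2\neq\sigma_2^2$, let $c>0$, and let $G=\alpha_1\delta_{\sigma_1^2}+\alpha_2\delta_{\sigma_2^2}$. Let $F^{c,G}$ be the limiting spectral distribution with dimensional ratio $c$ and mixing distribution $G$ (spherical case), that is, the probability measure on $\mathbb R$ whose Stieltjes transform $m(z)=\int\frac{1}{x-z}\,dF^{c,G}(x)$ satisfies $$z=-\frac1{m(z)}+\int\frac{t}{1+ct\,m(z)}\,dG(t)\qquad\text{for all } z\in\mathbb C,\ \operatorname{Im} z>0 .$$ Let $S_F$ be its support. Put $$u(x)=-\frac1x+\int\frac{t}{1+ctx}\,dG(t),\qquad f(x)=c-\int\Big(\frac{ctx}{1+ctx}\Big)^2dG(t),$$ for real $x\ne0$ with $1+c\sigma_i^2x\neq0$ $(i=1,2)$, and let $Z$ be the set of zeros of $f$ among these $x$. Then the equation $\int\frac{t^2}{(1+tx)^3}\,dG(t)=0$ (over real $x$ with $1+\sigma_i^2x\ne0$, $i=1,2$) has exactly one real root $x^*$, and with $$c_0=\int\frac{(tx^*)^2}{(1+tx^*)^2}\,dG(t)$$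 the following holds. (i) If $c>c_0$, there are real numbers $0\le s_1<s_2<s_3<s_4$, depending only on $c$ and $G$, such that $$S_F\setminus\{0\}=\big([s_1,s_2]\cup[s_3,s_4]\big)\setminus\{0\}.$$ Here $u(Z)=\{s_1,s_2,s_3,s_4\}$ if $c\neq1$, and $u(Z)=\{s_2,s_3,s_4\}$ if $c=1$. (ii) If $c\le c_0$, there are real numbers $0\le s_1<s_4$, depending only on $c$ and $G$, such that $$S_F\setminus\{0\}=[s_1,s_4]\setminus\{0\}.$$ Here $u(Z\setminus\{x^*/c\})=\{s_1,s_4\}$ if $c\ne1$, and $u(Z\setminus\{x^*/c\})=\{s_4\}$ if $c=1$. In both cases $s_1=0$ if and only if $c=1$; in particular, for $c\neq1$ the set $S_F\setminus\{0\}$ equals $[s_1,s_2]\cup[s_3,s_4]$, respectively $[s_1,s_4]$. -/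

import Mathlib

open MeasureTheory

noncomputable section

namespace ScaleMixture

/-- The Stieltjes transform `m_P(z) = ∫ 1 / (x - z) dP(x)`. -/
def stieltjes (P : Measure ℝ) (z : ℂ) : ℂ :=
  ∫ x : ℝ, 1 / ((x : ℂ) - z) ∂P

/-- `F` is the limiting spectral distribution with dimensional ratio `c`, mixing distribution `G`
and spherical population: the probability measure on `ℝ` whose Stieltjes transform `m` satisfies
`z = -1 / m + ∫ t / (1 + c t m) dG(t)` on the upper half-plane. (For such `z` one has `Im m > 0`,
so for real `t` no denominator vanishes.) -/
structure IsLSD (c : ℝ) (G F : Measure ℝ) : Prop where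
  isProbabilityMeasure : IsProbabilityMeasure F
  equation : ∀ z : ℂ, 0 < z.im →
    z = -1 / stieltjes F z +
      ∫ t : ℝ, (t : ℂ) / (1 + (c : ℂ) * (t : ℂ) * stieltjes F z) ∂G

/-- The two-point distribution `α₁ δ_{v₁} + α₂ δ_{v₂}`. -/
def twoAtom (α₁ α₂ v₁ v₂ : ℝ) : Measure ℝ :=
  ENNReal.ofReal α₁ • Measure.dirac v₁ + ENNReal.ofReal α₂ • Measure.dirac v₂

/-- `x` is a real root of `∫ t² / (1 + t x)³ dG(t) = 0` (with no vanishing denominator). -/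
def IsCriticalRoot (G : Measure ℝ) (x : ℝ) : Prop :=
  (∀ t ∈ G.support, 1 + t * x ≠ 0) ∧ ∫ t, t ^ 2 / (1 + t * x) ^ 3 ∂G = 0

/-- The value `∫ (t x)² / (1 + t x)² dG(t)`. -/
def criticalRatio (G : Measure ℝ) (x : ℝ) : ℝ :=
  ∫ t, (t * x) ^ 2 / (1 + t * x) ^ 2 ∂G

/-- The real function `u(x) = -1 / x + ∫ t / (1 + c t x) dG(t)`. -/
def u (c : ℝ) (G : Measure ℝ) (x : ℝ) : ℝ :=
  -1 / x + ∫ t, t / (1 + c * t * x) ∂G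

/-- The domain of `u`. -/
def uDomain (c : ℝ) (G : Measure ℝ) : Set ℝ :=
  {x | x ≠ 0 ∧ ∀ t ∈ G.support, 1 + c * t * x ≠ 0}

/-- The zeros, in the domain of `u`, of
`f(x) = c - ∫ (c t x / (1 + c t x))² dG(t) = c x² u'(x)`. -/
def criticalPoints (c : ℝ) (G : Measure ℝ) : Set ℝ :=
  {x ∈ uDomain c G | c - ∫ t, (c * t * x / (1 + c * t * x)) ^ 2 ∂G = 0}

end ScaleMixture

end

namespace ScaleMixture

open Filter Topology Set

/-! Let `a < b` be the atoms and pass to `r = 1 / (c x)`. Then `u` becomes `U(r) = -c r + p a r / (r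
+ a) + q b r / (r + b)`, and `f` becomes `c - g(r)` with `g(r) = p (a / (r + a))² + q (b / (r +
b))²`. Everything rests on the identity `U(r) - U(s) = (s - r) (c - B(r, s))` (`uInv_sub`), where
`B` is the symmetric form with `B(r, r) = g(r)`. Since `B(r, s) ≤ (g(r) + g(s)) / 2`, `U` is
strictly decreasing on `{g ≤ c}`, even across the poles (`uInv_lt_uInv`); this orders all the edges
at once.

The same identity with one complex argument `ρ = 1 / (c m(z))` shows that the complement of the
support is `U({g < c} \ {0})` (`IsLSD.compl_support`). Near a value `U(r)` with `g(r) < c`, it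
forces `ρ` close to `r`, so `Im m(z) = O(Im z)` and `F` has no mass there. Conversely, off the
support `m` has a real limit point on approach to the axis, and the imaginary part of the equation
gives `g < c` in the limit.

It remains to describe `{g < c}`. Outside `[-b, -a]`, `g` is monotone on each side and contributes
two rays. Between the poles it falls to a minimum at `ρ = 1 / x*` and rises again, so it contributes
an interval exactly when `c > g(ρ) = c₀`. Since `g(0) = 1` and `U(0) = 0`, the first edge is `0`
exactly when `c = 1`; the point `r = 0` stands for `x = ∞`, whence the removal of `0` from the
support. -/

/-- The integral `∫ (t / (r + t))² dG(t)` for the two-point distribution `G`; with `r = 1 / (c x)`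
it is `∫ (c t x / (1 + c t x))² dG(t)`. -/
noncomputable def ratioSum (p q a b r : ℝ) : ℝ := p * (a / (r + a)) ^ 2 + q * (b / (r + b)) ^ 2

/-- The function `u` for the two-point distribution in the coordinate `r = 1 / (c x)`. -/
noncomputable def uInv (c p q a b r : ℝ) : ℝ :=
  -c * r + (p * (a * r / (r + a)) + q * (b * r / (r + b)))

/-! ### The transformed functions on the real line -/

section Real

variable {c p q a b : ℝ}

lemma uInv_sub {r s : ℝ} (hra : r + a ≠ 0) (hrb : r + b ≠ 0) (hsa : s + a ≠ 0)
    (hsb : s + b ≠ 0) :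
    uInv c p q a b r - uInv c p q a b s =
      (s - r) * (c - (p * (a / (r + a) * (a / (s + a))) + q * (b / (r + b) * (b / (s + b))))) := by
  unfold uInv
  field_simp
  ring

/-- By `2xy ≤ x² + y²`, the mixed form in `uInv_sub` is at most the mean of the two values of
`ratioSum`, hence at most `c`; it is strictly smaller because `a / (r + a) ≠ a / (s + a)`. Nothing
is required between `r` and `s`, so a pole may separate them. -/
lemma uInv_lt_uInv (hp : 0 < p) (hq : 0 < q) (ha : 0 < a) {r s : ℝ}
    (hra : r + a ≠ 0) (hrb : r + b ≠ 0) (hsa : s + a ≠ 0) (hsb : s + b ≠ 0)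
    (hr : ratioSum p q a b r ≤ c) (hs : ratioSum p q a b s ≤ c) (hrs : r < s) :
    uInv c p q a b s < uInv c p q a b r := by
  rw [← sub_pos, uInv_sub hra hrb hsa hsb]
  refine mul_pos (by linarith) ?_
  unfold ratioSum at hr hs
  have hne : a / (r + a) - a / (s + a) ≠ 0 := by
    rw [div_sub_div _ _ hra hsa]
    refine div_ne_zero ?_ (mul_ne_zero hra hsa)
    have : a * (s - r) ≠ 0 := mul_ne_zero ha.ne' (by linarith)
    intro h
    apply this
    linarith
  have h1 : 0 < p * (a / (r + a) - a / (s + a)) ^ 2 := mul_pos hp (by positivity)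
  have h2 : 0 ≤ q * (b / (r + b) - b / (s + b)) ^ 2 := by positivity
  nlinarith

lemma continuousAt_ratioSum {r : ℝ} (hra : r + a ≠ 0) (hrb : r + b ≠ 0) :
    ContinuousAt (ratioSum p q a b) r := by
  unfold ratioSum
  fun_prop (disch := assumption)

lemma continuousAt_uInv {r : ℝ} (hra : r + a ≠ 0) (hrb : r + b ≠ 0) :
    ContinuousAt (uInv c p q a b) r := by
  unfold uInv
  fun_prop (disch := assumption)

lemma ratioSum_zero (hpq : p + q = 1) (ha : 0 < a) (hb : 0 < b) : ratioSum p q a b 0 = 1 := by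
  unfold ratioSum
  rw [zero_add, zero_add, div_self ha.ne', div_self hb.ne']
  linarith

lemma uInv_zero : uInv c p q a b 0 = 0 := by simp [uInv]

lemma strictAntiOn_ratioSum_right (hp : 0 < p) (hq : 0 < q) (ha : 0 < a) (hab : a < b) :
    StrictAntiOn (ratioSum p q a b) (Ioi (-a)) := by
  intro r hr s hs hrs
  simp only [mem_Ioi] at hr hs
  have h1 : 0 < r + a := by linarith
  have h2 : 0 < r + b := by linarith
  have hb : 0 < b := by linarith
  have h3 : 0 < s + a := by linarith
  have h4 : 0 < s + b := by linarith
  unfold ratioSum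
  gcongr

lemma strictMonoOn_ratioSum_left (hp : 0 < p) (hq : 0 < q) (ha : 0 < a) (hab : a < b) :
    StrictMonoOn (ratioSum p q a b) (Iio (-b)) := by
  intro r hr s hs hrs
  simp only [mem_Iio] at hr hs
  have hb : 0 < b := by linarith
  -- Left of both poles the denominators are negative; the square allows a change of sign, so that
  -- `gcongr` meets positive ones.
  have key : ∀ t : ℝ, ∀ y : ℝ, (t / (y + t)) ^ 2 = (t / (-(y + t))) ^ 2 := by
    intro t y
    rw [div_neg, neg_sq]
  have h1 : 0 < -(r + a) := by linarith
  have h2 : 0 < -(r + b) := by linarith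
  have h3 : 0 < -(s + a) := by linarith
  have h4 : 0 < -(s + b) := by linarith
  unfold ratioSum
  rw [key a r, key b r, key a s, key b s]
  gcongr

lemma tendsto_ratioSum_atTop : Tendsto (ratioSum p q a b) atTop (𝓝 0) := by
  have h : ∀ p a : ℝ, Tendsto (fun r : ℝ => p * (a / (r + a)) ^ 2) atTop (𝓝 0) := by
    intro p a
    have := ((tendsto_const_nhds (x := a)).div_atTop
      (tendsto_atTop_add_const_right atTop a tendsto_id)).pow 2 |>.const_mul p
    simpa using this
  simpa only [add_zero] using! (h p a).add (h q b)

lemma tendsto_ratioSum_atBot : Tendsto (ratioSum p q a b) atBot (𝓝 0) := by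
  have h : ∀ p a : ℝ, Tendsto (fun r : ℝ => p * (a / (r + a)) ^ 2) atBot (𝓝 0) := by
    intro p a
    have := ((tendsto_const_nhds (x := a)).div_atBot
      (tendsto_atBot_add_const_right atBot a tendsto_id)).pow 2 |>.const_mul p
    simpa using this
  simpa only [add_zero] using! (h p a).add (h q b)

lemma tendsto_mul_div_add_sq (hp : 0 < p) (ha : 0 < a) :
    Tendsto (fun r : ℝ => p * (a / (r + a)) ^ 2) (𝓝[≠] (-a)) atTop := by
  have h0 : Tendsto (fun r : ℝ => (r + a) ^ 2) (𝓝[≠] (-a)) (𝓝[>] 0) := by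
    refine tendsto_nhdsWithin_iff.2 ⟨?_, ?_⟩
    · have : ContinuousAt (fun r : ℝ => (r + a) ^ 2) (-a) := by fun_prop
      have h := this.tendsto
      simp only [neg_add_cancel, ne_eq, OfNat.ofNat_ne_zero, not_false_eq_true, zero_pow] at h
      exact h.mono_left nhdsWithin_le_nhds
    · filter_upwards [self_mem_nhdsWithin] with r hr
      have : r + a ≠ 0 := fun h => hr (by simp only [mem_singleton_iff]; linarith)
      exact mem_Ioi.2 (by positivity)
  have h1 := (tendsto_inv_nhdsGT_zero.comp h0).const_mul_atTop (show 0 < p * a ^ 2 by positivity)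
  refine h1.congr fun r => ?_
  simp only [Function.comp]
  rw [div_pow]
  ring

lemma tendsto_ratioSum_neg_left (hp : 0 < p) (hq : 0 ≤ q) (ha : 0 < a) :
    Tendsto (ratioSum p q a b) (𝓝[≠] (-a)) atTop :=
  tendsto_atTop_mono (fun r => le_add_of_nonneg_right (by positivity))
    (tendsto_mul_div_add_sq hp ha)

lemma ratioSum_swap : ratioSum p q a b = ratioSum q p b a := by
  ext r
  exact add_comm _ _

lemma tendsto_ratioSum_neg_right (hp : 0 ≤ p) (hq : 0 < q) (hb : 0 < b) :
    Tendsto (ratioSum p q a b) (𝓝[≠] (-b)) atTop :=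
  ratioSum_swap (p := p) ▸ tendsto_ratioSum_neg_left hq hp hb

lemma exists_ratioSum_eq_right (hc : 0 < c) (hp : 0 < p) (hq : 0 < q) (ha : 0 < a) (hab : a < b) :
    ∃ r ∈ Ioi (-a), ratioSum p q a b r = c := by
  have hcont : ContinuousOn (ratioSum p q a b) (Ioi (-a)) := fun r hr =>
    (continuousAt_ratioSum (by rw [mem_Ioi] at hr; linarith)
      (by rw [mem_Ioi] at hr; linarith)).continuousWithinAt
  exact isPreconnected_Ioi.intermediate_value_Ioi (l₁ := atTop) (l₂ := 𝓝[>] (-a))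
    (le_principal_iff.2 (Ioi_mem_atTop _)) (le_principal_iff.2 self_mem_nhdsWithin) hcont
    tendsto_ratioSum_atTop ((tendsto_ratioSum_neg_left hp hq.le ha).mono_left
      (nhdsWithin_mono _ fun x hx => ne_of_gt hx)) hc

lemma exists_ratioSum_eq_left (hc : 0 < c) (hp : 0 < p) (hq : 0 < q) (ha : 0 < a) (hab : a < b) :
    ∃ r ∈ Iio (-b), ratioSum p q a b r = c := by
  have hcont : ContinuousOn (ratioSum p q a b) (Iio (-b)) := fun r hr =>
    (continuousAt_ratioSum (by rw [mem_Iio] at hr; linarith)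
      (by rw [mem_Iio] at hr; linarith)).continuousWithinAt
  exact isPreconnected_Iio.intermediate_value_Ioi (l₁ := atBot) (l₂ := 𝓝[<] (-b))
    (le_principal_iff.2 (Iio_mem_atBot _)) (le_principal_iff.2 self_mem_nhdsWithin) hcont
    tendsto_ratioSum_atBot ((tendsto_ratioSum_neg_right hp.le hq (ha.trans hab)).mono_left
      (nhdsWithin_mono _ fun x hx => ne_of_lt hx)) hc

lemma hasDerivAt_ratioSum {r : ℝ} (hra : r + a ≠ 0) (hrb : r + b ≠ 0) :
    HasDerivAt (ratioSum p q a b)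
      (-2 * (p * a ^ 2 / (r + a) ^ 3 + q * b ^ 2 / (r + b) ^ 3)) r := by
  have h : ∀ p a : ℝ, r + a ≠ 0 →
      HasDerivAt (fun r : ℝ => p * (a / (r + a)) ^ 2) (-2 * (p * a ^ 2 / (r + a) ^ 3)) r := by
    intro p a h
    have := ((((hasDerivAt_id r).add_const a).inv h).const_mul a).pow 2 |>.const_mul p
    refine (this.congr_deriv ?_).congr_of_eventuallyEq (Eventually.of_forall fun y => ?_)
    · simp only [id, Nat.cast_ofNat, Nat.add_one_sub_one, pow_one, Pi.inv_apply]
      field_simp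
    · simp [div_eq_mul_inv]
  exact ((h p a hra).add (h q b hrb)).congr_deriv (by ring)

/-- The real cube root of a positive number. -/
lemma exists_pos_cube_eq {x : ℝ} (hx : 0 < x) : ∃ y : ℝ, 0 < y ∧ y ^ 3 = x :=
  ⟨x ^ ((3 : ℕ) : ℝ)⁻¹, Real.rpow_pos_of_pos hx _, Real.rpow_inv_natCast_pow hx.le (by norm_num)⟩

/-- The minimiser of `ratioSum` between its poles. -/
lemma exists_middle_min (hp : 0 < p) (hq : 0 < q) (ha : 0 < a) (hab : a < b) :
    ∃ ρ : ℝ, -b < ρ ∧ ρ < -a ∧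
      (∀ r : ℝ, r + a ≠ 0 → r + b ≠ 0 →
        (p * a ^ 2 / (r + a) ^ 3 + q * b ^ 2 / (r + b) ^ 3 = 0 ↔ r = ρ)) ∧
      StrictAntiOn (ratioSum p q a b) (Ioc (-b) ρ) ∧
      StrictMonoOn (ratioSum p q a b) (Ico ρ (-a)) := by
  have hb : 0 < b := ha.trans hab
  -- With cube roots `A`, `B` of the weights the derivative is a multiple of a sum of two cubes.
  -- Since cubing is strictly increasing, its sign is that of `A / (r + a) + B / (r + b)`, whose
  -- numerator is linear in `r`.
  obtain ⟨A, hA, hA3⟩ := exists_pos_cube_eq (show 0 < p * a ^ 2 by positivity)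
  obtain ⟨B, hB, hB3⟩ := exists_pos_cube_eq (show 0 < q * b ^ 2 by positivity)
  have hAB : 0 < A + B := by positivity
  have hodd : Odd 3 := by decide
  have hcube : ∀ r : ℝ, p * a ^ 2 / (r + a) ^ 3 + q * b ^ 2 / (r + b) ^ 3 =
      (A / (r + a)) ^ 3 - (-(B / (r + b))) ^ 3 := by
    intro r
    rw [hodd.neg_pow, div_pow, div_pow, hA3, hB3]
    ring
  have hsum : ∀ r : ℝ, r + a ≠ 0 → r + b ≠ 0 →
      A / (r + a) - -(B / (r + b)) =
        (A + B) * (r - -(A * b + B * a) / (A + B)) / ((r + a) * (r + b)) := by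
    intro r hra hrb
    field_simp
    ring
  have hρb : -b < -(A * b + B * a) / (A + B) := by
    rw [lt_div_iff₀ hAB]
    nlinarith
  have hρa : -(A * b + B * a) / (A + B) < -a := by
    rw [div_lt_iff₀ hAB]
    nlinarith
  refine ⟨-(A * b + B * a) / (A + B), hρb, hρa, fun r hra hrb => ?_, ?_, ?_⟩
  · rw [hcube, sub_eq_zero, hodd.strictMono_pow.injective.eq_iff, ← sub_eq_zero, hsum r hra hrb,
      div_eq_zero_iff, or_iff_left (mul_ne_zero hra hrb), mul_eq_zero, or_iff_right hAB.ne',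
      sub_eq_zero]
  · refine strictAntiOn_of_deriv_neg (convex_Ioc _ _) (fun r hr => ?_) fun r hr => ?_
    · exact (continuousAt_ratioSum (by linarith [hr.2]) (by linarith [hr.1])).continuousWithinAt
    · rw [interior_Ioc] at hr
      have hra : r + a < 0 := by linarith [hr.2]
      have hrb : 0 < r + b := by linarith [hr.1]
      rw [(hasDerivAt_ratioSum hra.ne hrb.ne').deriv, hcube]
      have : 0 < A / (r + a) - -(B / (r + b)) := by
        rw [hsum r hra.ne hrb.ne']
        exact div_pos_of_neg_of_neg (mul_neg_of_pos_of_neg hAB (by linarith [hr.2]))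
          (mul_neg_of_neg_of_pos hra hrb)
      have := hodd.strictMono_pow (R := ℝ) (sub_pos.1 this)
      linarith
  · refine strictMonoOn_of_deriv_pos (convex_Ico _ _) (fun r hr => ?_) fun r hr => ?_
    · exact (continuousAt_ratioSum (by linarith [hr.2]) (by linarith [hr.1])).continuousWithinAt
    · rw [interior_Ico] at hr
      have hra : r + a < 0 := by linarith [hr.2]
      have hrb : 0 < r + b := by linarith [hr.1]
      rw [(hasDerivAt_ratioSum hra.ne hrb.ne').deriv, hcube]
      have : A / (r + a) - -(B / (r + b)) < 0 := by
        rw [hsum r hra.ne hrb.ne']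
        exact div_neg_of_pos_of_neg (mul_pos hAB (by linarith [hr.1]))
          (mul_neg_of_neg_of_pos hra hrb)
      have := hodd.strictMono_pow (R := ℝ) (sub_neg.1 this)
      linarith

lemma exists_ratioSum_eq_middle (hp : 0 < p) (hq : 0 < q) (ha : 0 < a) (hb : 0 < b)
    {ρ : ℝ} (hρb : -b < ρ) (hρa : ρ < -a) (hc : ratioSum p q a b ρ < c) :
    ∃ r₃ ∈ Ioo (-b) ρ, ∃ r₂ ∈ Ioo ρ (-a), ratioSum p q a b r₃ = c ∧ ratioSum p q a b r₂ = c := by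
  have hcont : ContinuousOn (ratioSum p q a b) (Ioo (-b) (-a)) := fun r hr =>
    (continuousAt_ratioSum (by linarith [hr.2]) (by linarith [hr.1])).continuousWithinAt
  obtain ⟨r₃, hr₃, h₃⟩ := (isPreconnected_Ioc (a := -b) (b := ρ)).intermediate_value_Ici
    (right_mem_Ioc.2 hρb) (l := 𝓝[>] (-b)) (le_principal_iff.2 (Ioc_mem_nhdsGT hρb))
    (hcont.mono fun x hx => ⟨hx.1, hx.2.trans_lt hρa⟩)
    ((tendsto_ratioSum_neg_right hp.le hq hb).mono_left
      (nhdsWithin_mono _ fun x hx => ne_of_gt hx)) hc.le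
  obtain ⟨r₂, hr₂, h₂⟩ := (isPreconnected_Ico (a := ρ) (b := -a)).intermediate_value_Ici
    (left_mem_Ico.2 hρa) (l := 𝓝[<] (-a)) (le_principal_iff.2 (Ico_mem_nhdsLT hρa))
    (hcont.mono fun x hx => ⟨hρb.trans_le hx.1, hx.2⟩)
    ((tendsto_ratioSum_neg_left hp hq.le ha).mono_left
      (nhdsWithin_mono _ fun x hx => ne_of_lt hx)) hc.le
  have h3 : r₃ ≠ ρ := by
    rintro rfl
    exact hc.ne h₃
  have h2 : ρ ≠ r₂ := by
    rintro rfl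
    exact hc.ne h₂
  exact ⟨r₃, ⟨hr₃.1, lt_of_le_of_ne hr₃.2 h3⟩, r₂, ⟨lt_of_le_of_ne hr₂.1 h2, hr₂.2⟩, h₃, h₂⟩

lemma Iio_uInv_subset (hc : 0 < c) (hp : 0 < p) (hq : 0 < q) (ha : 0 < a) (hab : a < b) {r : ℝ}
    (hr : -a < r) : Iio (uInv c p q a b r) ⊆ uInv c p q a b '' Ioi r := by
  intro s hs
  have hb := ha.trans hab
  -- Right of `-a` one has `U(R) ≤ p a + q b - c R`; this `R` makes the bound at most `s`.
  set R := max r ((p * a + q * b - s) / c)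
  have hrR : r ≤ R := le_max_left _ _
  have hR : uInv c p q a b R ≤ s := by
    have h1 : (p * a + q * b - s) / c ≤ R := le_max_right _ _
    rw [div_le_iff₀ hc] at h1
    have h2 : a * R / (R + a) ≤ a := by
      rw [div_le_iff₀ (by linarith)]
      nlinarith
    have h3 : b * R / (R + b) ≤ b := by
      rw [div_le_iff₀ (by linarith)]
      nlinarith
    unfold uInv
    nlinarith
  obtain ⟨x, hx, rfl⟩ := intermediate_value_Icc' hrR (f := uInv c p q a b)
    (fun x hx => (continuousAt_uInv (by linarith [hx.1]) (by linarith [hx.1])).continuousWithinAt)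
    ⟨hR, (mem_Iio.1 hs).le⟩
  refine ⟨x, lt_of_le_of_ne hx.1 ?_, rfl⟩
  rintro rfl
  exact (lt_irrefl _ (mem_Iio.1 hs)).elim

lemma Ioi_uInv_subset (hc : 0 < c) (hp : 0 < p) (hq : 0 < q) (ha : 0 < a) (hab : a < b) {r : ℝ}
    (hr : r < -b) : Ioi (uInv c p q a b r) ⊆ uInv c p q a b '' Iio r := by
  intro s hs
  have hb := ha.trans hab
  set R := min r ((p * a + q * b - s) / c)
  have hrR : R ≤ r := min_le_left _ _
  have hR : s ≤ uInv c p q a b R := by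
    have h1 : R ≤ (p * a + q * b - s) / c := min_le_right _ _
    rw [le_div_iff₀ hc] at h1
    have h2 : a ≤ a * R / (R + a) := by
      rw [le_div_iff_of_neg (by linarith)]
      nlinarith
    have h3 : b ≤ b * R / (R + b) := by
      rw [le_div_iff_of_neg (by linarith)]
      nlinarith
    unfold uInv
    nlinarith
  obtain ⟨x, hx, rfl⟩ := intermediate_value_Icc' hrR (f := uInv c p q a b)
    (fun x hx => (continuousAt_uInv (by linarith [hx.2]) (by linarith [hx.2])).continuousWithinAt)
    ⟨(mem_Ioi.1 hs).le, hR⟩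
  refine ⟨x, lt_of_le_of_ne hx.2 ?_, rfl⟩
  rintro rfl
  exact (lt_irrefl _ (mem_Ioi.1 hs)).elim

/-- The sign of the left edge. -/
lemma uInv_right_edge (hp : 0 < p) (hq : 0 < q) (hpq : p + q = 1) (ha : 0 < a) (hab : a < b)
    {r : ℝ} (hr : -a < r) (hrc : ratioSum p q a b r = c) :
    (r = 0 ↔ c = 1) ∧ 0 ≤ uInv c p q a b r ∧ (uInv c p q a b r = 0 ↔ c = 1) := by
  have hb := ha.trans hab
  have hanti := strictAntiOn_ratioSum_right hp hq ha hab
  have h0 : ratioSum p q a b 0 = 1 := ratioSum_zero hpq ha hb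
  have hmem : (0 : ℝ) ∈ Ioi (-a) := by simpa using ha
  have hr0 : r = 0 ↔ c = 1 := by
    rw [← hrc, ← h0]
    exact (hanti.injOn.eq_iff hr hmem).symm
  have hpos : r ≠ 0 → 0 < uInv c p q a b r := by
    intro h
    rcases lt_or_gt_of_ne h with h | h
    · have hc1 : 1 < c := by
        rw [← hrc, ← h0]
        exact hanti hr hmem h
      -- Here `ratioSum` is at most `c` at both `r` and `0`, so `U(r) > U(0) = 0`.
      have := uInv_lt_uInv (c := c) hp hq ha (b := b) (r := r) (s := 0) (by linarith) (by linarith)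
        (by linarith) (by linarith) hrc.le (by linarith) h
      rwa [uInv_zero] at this
    -- Substituting `c = ratioSum r` gives terms `w (1 - w)` with `w = t / (r + t)`, which lies in
    -- `(0, 1)` for `r > 0`.
    · have e : uInv c p q a b r = r * (p * (a / (r + a) * (1 - a / (r + a))) +
          q * (b / (r + b) * (1 - b / (r + b)))) := by
        rw [uInv, ← hrc, ratioSum]
        ring
      have h1 : ∀ t : ℝ, 0 < t → 0 < t / (r + t) * (1 - t / (r + t)) := by
        intro t ht
        refine mul_pos (by positivity) (sub_pos.2 ?_)
        rw [div_lt_one (by positivity)]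
        linarith
      rw [e]
      have := h1 a ha
      have := h1 b hb
      positivity
  refine ⟨hr0, ?_, ?_⟩
  · rcases eq_or_ne r 0 with h | h
    · rw [h, uInv_zero]
    · exact (hpos h).le
  · rw [← hr0]
    refine ⟨fun h => by_contra fun h' => (hpos h').ne' h, fun h => by rw [h, uInv_zero]⟩

end Real

/-- The points `r` off the poles with `ratioSum r < c`. -/
def subcritical (c p q a b : ℝ) : Set ℝ :=
  {r | r + a ≠ 0 ∧ r + b ≠ 0 ∧ ratioSum p q a b r < c}

/-- The points `r` off the poles with `ratioSum r = c`. -/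
def levelSet (c p q a b : ℝ) : Set ℝ :=
  {r | r + a ≠ 0 ∧ r + b ≠ 0 ∧ ratioSum p q a b r = c}

/-! ### Edges and components of the subcritical set -/

section Real

variable {c p q a b : ℝ}

lemma exists_right_edge (hc : 0 < c) (hp : 0 < p) (hq : 0 < q) (ha : 0 < a) (hab : a < b) :
    ∃ r₁, -a < r₁ ∧ ratioSum p q a b r₁ = c ∧
      ∀ r, -a < r → (ratioSum p q a b r < c ↔ r₁ < r) ∧ (ratioSum p q a b r = c ↔ r = r₁) := by
  obtain ⟨r₁, h, rfl⟩ := exists_ratioSum_eq_right hc hp hq ha hab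
  have hanti := strictAntiOn_ratioSum_right hp hq ha hab
  exact ⟨r₁, h, rfl, fun r hr => ⟨hanti.lt_iff_gt hr h, hanti.injOn.eq_iff hr h⟩⟩

lemma exists_left_edge (hc : 0 < c) (hp : 0 < p) (hq : 0 < q) (ha : 0 < a) (hab : a < b) :
    ∃ r₄, r₄ < -b ∧ ratioSum p q a b r₄ = c ∧
      ∀ r, r < -b → (ratioSum p q a b r < c ↔ r < r₄) ∧ (ratioSum p q a b r = c ↔ r = r₄) := by
  obtain ⟨r₄, h, rfl⟩ := exists_ratioSum_eq_left hc hp hq ha hab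
  have hmono := strictMonoOn_ratioSum_left hp hq ha hab
  exact ⟨r₄, h, rfl, fun r hr => ⟨hmono.lt_iff_lt hr h, hmono.injOn.eq_iff hr h⟩⟩

/-- The three intervals cut out by the poles. -/
lemma off_poles_cases {r : ℝ} (hra : r + a ≠ 0) (hrb : r + b ≠ 0) :
    -a < r ∨ (-b < r ∧ r < -a) ∨ r < -b := by
  rcases lt_or_gt_of_ne hra with h | h
  · rcases lt_or_gt_of_ne hrb with h' | h'
    · exact Or.inr (Or.inr (by linarith))
    · exact Or.inr (Or.inl ⟨by linarith, by linarith⟩)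
  · exact Or.inl (by linarith)

lemma image_uInv_Ioi (hc : 0 < c) (hp : 0 < p) (hq : 0 < q) (ha : 0 < a) (hab : a < b) {r₁ : ℝ}
    (h₁ : -a < r₁) (hg : ∀ r, r₁ ≤ r → ratioSum p q a b r ≤ c) :
    uInv c p q a b '' Ioi r₁ = Iio (uInv c p q a b r₁) := by
  refine Subset.antisymm ?_ (Iio_uInv_subset hc hp hq ha hab h₁)
  rintro _ ⟨r, hr, rfl⟩
  have hr := mem_Ioi.1 hr
  exact uInv_lt_uInv hp hq ha (by linarith) (by linarith) (by linarith) (by linarith)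
    (hg _ le_rfl) (hg _ hr.le) hr

lemma image_uInv_Iio (hc : 0 < c) (hp : 0 < p) (hq : 0 < q) (ha : 0 < a) (hab : a < b) {r₄ : ℝ}
    (h₄ : r₄ < -b) (hg : ∀ r, r ≤ r₄ → ratioSum p q a b r ≤ c) :
    uInv c p q a b '' Iio r₄ = Ioi (uInv c p q a b r₄) := by
  refine Subset.antisymm ?_ (Ioi_uInv_subset hc hp hq ha hab h₄)
  rintro _ ⟨r, hr, rfl⟩
  have hr := mem_Iio.1 hr
  exact uInv_lt_uInv hp hq ha (by linarith) (by linarith) (by linarith) (by linarith)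
    (hg _ hr.le) (hg _ le_rfl) hr

lemma image_uInv_Ioo (hp : 0 < p) (hq : 0 < q) (ha : 0 < a) {r₃ r₂ : ℝ}
    (h₃₂ : r₃ < r₂) (hpole : ∀ r ∈ Icc r₃ r₂, r + a ≠ 0 ∧ r + b ≠ 0)
    (hg : ∀ r ∈ Icc r₃ r₂, ratioSum p q a b r ≤ c) :
    uInv c p q a b '' Ioo r₃ r₂ = Ioo (uInv c p q a b r₂) (uInv c p q a b r₃) := by
  have hlt : ∀ r ∈ Icc r₃ r₂, ∀ s ∈ Icc r₃ r₂, r < s → uInv c p q a b s < uInv c p q a b r :=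
    fun r hr s hs hrs => uInv_lt_uInv hp hq ha (hpole r hr).1 (hpole r hr).2 (hpole s hs).1
      (hpole s hs).2 (hg r hr) (hg s hs) hrs
  refine Subset.antisymm ?_ (intermediate_value_Ioo' h₃₂.le fun r hr =>
    (continuousAt_uInv (hpole r hr).1 (hpole r hr).2).continuousWithinAt)
  rintro _ ⟨r, hr, rfl⟩
  exact ⟨hlt r ⟨hr.1.le, hr.2.le⟩ r₂ (right_mem_Icc.2 h₃₂.le) hr.2,
    hlt r₃ (left_mem_Icc.2 h₃₂.le) r ⟨hr.1.le, hr.2.le⟩ hr.1⟩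

/-- Above the critical ratio there are four critical points and the image of the subcritical set
has three components. -/
lemma exists_four_edges (hc : 0 < c) (hp : 0 < p) (hq : 0 < q) (hpq : p + q = 1) (ha : 0 < a)
    (hab : a < b) {ρ : ℝ} (hρb : -b < ρ) (hρa : ρ < -a)
    (hanti : StrictAntiOn (ratioSum p q a b) (Ioc (-b) ρ))
    (hmono : StrictMonoOn (ratioSum p q a b) (Ico ρ (-a))) (hcρ : ratioSum p q a b ρ < c) :
    ∃ r₁ r₂ r₃ r₄ : ℝ, r₄ < r₃ ∧ r₃ < r₂ ∧ r₂ < r₁ ∧ r₂ < 0 ∧ (r₁ = 0 ↔ c = 1) ∧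
      levelSet c p q a b = {r₁, r₂, r₃, r₄} ∧
      0 ≤ uInv c p q a b r₁ ∧ (uInv c p q a b r₁ = 0 ↔ c = 1) ∧
      uInv c p q a b r₁ < uInv c p q a b r₂ ∧ uInv c p q a b r₂ < uInv c p q a b r₃ ∧
      uInv c p q a b r₃ < uInv c p q a b r₄ ∧
      uInv c p q a b '' subcritical c p q a b = Iio (uInv c p q a b r₁) ∪
        Ioo (uInv c p q a b r₂) (uInv c p q a b r₃) ∪ Ioi (uInv c p q a b r₄) := by
  obtain ⟨r₁, h₁, hg₁, hr₁⟩ := exists_right_edge hc hp hq ha hab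
  obtain ⟨r₄, h₄, hg₄, hr₄⟩ := exists_left_edge hc hp hq ha hab
  obtain ⟨r₃, h₃, r₂, h₂, hg₃, hg₂⟩ := exists_ratioSum_eq_middle hp hq ha (ha.trans hab) hρb hρa hcρ
  have hl : ∀ r, -b < r → r ≤ ρ → (ratioSum p q a b r < c ↔ r₃ < r) ∧
      (ratioSum p q a b r = c ↔ r = r₃) := by
    intro r h h'
    rw [← hg₃]
    exact ⟨hanti.lt_iff_gt ⟨h, h'⟩ ⟨h₃.1, h₃.2.le⟩, hanti.injOn.eq_iff ⟨h, h'⟩ ⟨h₃.1, h₃.2.le⟩⟩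
  have hr : ∀ r, ρ ≤ r → r < -a → (ratioSum p q a b r < c ↔ r < r₂) ∧
      (ratioSum p q a b r = c ↔ r = r₂) := by
    intro r h h'
    rw [← hg₂]
    exact ⟨hmono.lt_iff_lt ⟨h, h'⟩ ⟨h₂.1.le, h₂.2⟩, hmono.injOn.eq_iff ⟨h, h'⟩ ⟨h₂.1.le, h₂.2⟩⟩
  have h₃b := h₃.1
  have h₃ρ := h₃.2
  have h₂ρ := h₂.1
  have h₂a := h₂.2
  have hsub : subcritical c p q a b = Ioi r₁ ∪ Ioo r₃ r₂ ∪ Iio r₄ := by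
    ext r
    simp only [subcritical, mem_ofPred_eq, mem_union, mem_Ioi, mem_Ioo, mem_Iio]
    constructor
    · rintro ⟨hra, hrb, hrc⟩
      rcases off_poles_cases hra hrb with h | h | h
      · exact Or.inl (Or.inl ((hr₁ r h).1.1 hrc))
      · refine Or.inl (Or.inr ?_)
        rcases le_total r ρ with h' | h'
        · exact ⟨(hl r h.1 h').1.1 hrc, by linarith⟩
        · exact ⟨by linarith, (hr r h' h.2).1.1 hrc⟩
      · exact Or.inr ((hr₄ r h).1.1 hrc)
    · rintro ((h | h) | h)
      · exact ⟨by linarith, by linarith, (hr₁ r (by linarith)).1.2 h⟩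
      · refine ⟨by linarith [h.2], by linarith [h.1], ?_⟩
        rcases le_total r ρ with h' | h'
        · exact (hl r (by linarith [h.1]) h').1.2 h.1
        · exact (hr r h' (by linarith [h.2])).1.2 h.2
      · exact ⟨by linarith, by linarith, (hr₄ r (by linarith)).1.2 h⟩
  have hlev : levelSet c p q a b = {r₁, r₂, r₃, r₄} := by
    ext r
    simp only [levelSet, mem_ofPred_eq, mem_insert_iff, mem_singleton_iff]
    constructor
    · rintro ⟨hra, hrb, hrc⟩
      rcases off_poles_cases hra hrb with h | h | h
      · exact Or.inl ((hr₁ r h).2.1 hrc)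
      · rcases le_total r ρ with h' | h'
        · exact Or.inr (Or.inr (Or.inl ((hl r h.1 h').2.1 hrc)))
        · exact Or.inr (Or.inl ((hr r h' h.2).2.1 hrc))
      · exact Or.inr (Or.inr (Or.inr ((hr₄ r h).2.1 hrc)))
    · rintro (rfl | rfl | rfl | rfl)
      · exact ⟨by linarith, by linarith, hg₁⟩
      · exact ⟨by linarith, by linarith, hg₂⟩
      · exact ⟨by linarith, by linarith, hg₃⟩
      · exact ⟨by linarith, by linarith, hg₄⟩
  obtain ⟨e₁, e₂, e₃⟩ := uInv_right_edge hp hq hpq ha hab h₁ hg₁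
  refine ⟨r₁, r₂, r₃, r₄, by linarith, by linarith, by linarith, by linarith, e₁, hlev, e₂, e₃,
    ?_, ?_, ?_, ?_⟩
  -- The points `r₂ < -a < r₁` are separated by a pole, as are `r₄ < -b < r₃` below.
  · exact uInv_lt_uInv hp hq ha (by linarith) (by linarith) (by linarith) (by linarith)
      hg₂.le hg₁.le (by linarith)
  · exact uInv_lt_uInv hp hq ha (by linarith) (by linarith) (by linarith) (by linarith)
      hg₃.le hg₂.le (by linarith)
  · exact uInv_lt_uInv hp hq ha (by linarith) (by linarith) (by linarith) (by linarith)
      hg₄.le hg₃.le (by linarith)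
  · rw [hsub, image_union, image_union, image_uInv_Ioi hc hp hq ha hab h₁,
      image_uInv_Iio hc hp hq ha hab h₄, image_uInv_Ioo hp hq ha (by linarith)]
    · exact fun r h => ⟨by linarith [h.2], by linarith [h.1]⟩
    · intro r h
      rcases le_total r ρ with h' | h'
      · rw [← hg₃]
        exact hanti.antitoneOn ⟨h₃b, h₃ρ.le⟩ ⟨by linarith [h.1], h'⟩ h.1
      · rw [← hg₂]
        exact hmono.monotoneOn ⟨h', by linarith [h.2]⟩ ⟨h₂ρ.le, h₂a⟩ h.2
    · intro r h
      rcases h.eq_or_lt with rfl | h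
      · exact hg₄.le
      · exact ((hr₄ r (by linarith)).1.2 h).le
    · intro r h
      rcases h.eq_or_lt with rfl | h
      · exact hg₁.le
      · exact ((hr₁ r (by linarith)).1.2 h).le

/-- Up to the critical ratio there are two critical points besides possibly the minimiser `ρ`, and
the image of the subcritical set has two components. -/
lemma exists_two_edges (hc : 0 < c) (hp : 0 < p) (hq : 0 < q) (hpq : p + q = 1) (ha : 0 < a)
    (hab : a < b) {ρ : ℝ} (hρb : -b < ρ) (hρa : ρ < -a)
    (hanti : StrictAntiOn (ratioSum p q a b) (Ioc (-b) ρ))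
    (hmono : StrictMonoOn (ratioSum p q a b) (Ico ρ (-a))) (hcρ : c ≤ ratioSum p q a b ρ) :
    ∃ r₁ r₄ : ℝ, r₄ < r₁ ∧ r₄ < 0 ∧ (r₁ = 0 ↔ c = 1) ∧
      levelSet c p q a b \ {ρ} = {r₁, r₄} ∧
      0 ≤ uInv c p q a b r₁ ∧ (uInv c p q a b r₁ = 0 ↔ c = 1) ∧
      uInv c p q a b r₁ < uInv c p q a b r₄ ∧
      uInv c p q a b '' subcritical c p q a b = Iio (uInv c p q a b r₁) ∪
        Ioi (uInv c p q a b r₄) := by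
  obtain ⟨r₁, h₁, hg₁, hr₁⟩ := exists_right_edge hc hp hq ha hab
  obtain ⟨r₄, h₄, hg₄, hr₄⟩ := exists_left_edge hc hp hq ha hab
  -- The interval between the poles contains no subcritical point. If `c` equals the minimum, `ρ` is
  -- a critical point without a sign change, so it is no edge.
  have hmid : ∀ r, -b < r → r < -a → r ≠ ρ → c < ratioSum p q a b r := by
    intro r h h' hne
    rcases lt_or_gt_of_ne hne with hlt | hgt
    · exact hcρ.trans_lt (hanti ⟨h, hlt.le⟩ ⟨hρb, le_rfl⟩ hlt)
    · exact hcρ.trans_lt (hmono ⟨le_rfl, hρa⟩ ⟨hgt.le, h'⟩ hgt)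
  have hsub : subcritical c p q a b = Ioi r₁ ∪ Iio r₄ := by
    ext r
    simp only [subcritical, mem_ofPred_eq, mem_union, mem_Ioi, mem_Iio]
    constructor
    · rintro ⟨hra, hrb, hrc⟩
      rcases off_poles_cases hra hrb with h | h | h
      · exact Or.inl ((hr₁ r h).1.1 hrc)
      · rcases eq_or_ne r ρ with rfl | hne
        · exact absurd hrc hcρ.not_gt
        · exact absurd hrc (hmid r h.1 h.2 hne).not_gt
      · exact Or.inr ((hr₄ r h).1.1 hrc)
    · rintro (h | h)
      · exact ⟨by linarith, by linarith, (hr₁ r (by linarith)).1.2 h⟩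
      · exact ⟨by linarith, by linarith, (hr₄ r (by linarith)).1.2 h⟩
  have hlev : levelSet c p q a b \ {ρ} = {r₁, r₄} := by
    ext r
    simp only [levelSet, Set.mem_sdiff, mem_ofPred_eq, mem_insert_iff, mem_singleton_iff]
    constructor
    · rintro ⟨⟨hra, hrb, hrc⟩, hne⟩
      rcases off_poles_cases hra hrb with h | h | h
      · exact Or.inl ((hr₁ r h).2.1 hrc)
      · exact absurd hrc (hmid r h.1 h.2 hne).ne'
      · exact Or.inr ((hr₄ r h).2.1 hrc)
    · rintro (rfl | rfl)
      · exact ⟨⟨by linarith, by linarith, hg₁⟩, by linarith⟩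
      · exact ⟨⟨by linarith, by linarith, hg₄⟩, by linarith⟩
  obtain ⟨e₁, e₂, e₃⟩ := uInv_right_edge hp hq hpq ha hab h₁ hg₁
  refine ⟨r₁, r₄, by linarith, by linarith, e₁, hlev, e₂, e₃, ?_, ?_⟩
  · exact uInv_lt_uInv hp hq ha (by linarith) (by linarith) (by linarith) (by linarith)
      hg₄.le hg₁.le (by linarith)
  · rw [hsub, image_union, image_uInv_Ioi hc hp hq ha hab h₁, image_uInv_Iio hc hp hq ha hab h₄]
    · intro r h
      rcases h.eq_or_lt with rfl | h
      · exact hg₄.le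
      · exact ((hr₄ r (by linarith)).1.2 h).le
    · intro r h
      rcases h.eq_or_lt with rfl | h
      · exact hg₁.le
      · exact ((hr₁ r (by linarith)).1.2 h).le

end Real

/-! ### Translation from `x` to `r = 1 / (c x)` -/

section TwoAtom

variable {c p q a b : ℝ}

lemma support_twoAtom (hp : 0 < p) (hq : 0 < q) :
    (twoAtom p q a b).support = {a, b} := by
  have h : ∀ p a : ℝ, 0 < p → (ENNReal.ofReal p • Measure.dirac a).support = {a} := by
    intro p a hp
    ext x
    rw [Measure.mem_support_iff_forall, mem_singleton_iff]
    constructor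
    · intro h
      by_contra hne
      have := h {a}ᶜ (isOpen_compl_singleton.mem_nhds hne)
      simp at this
    · rintro rfl U hU
      have hx : x ∈ U := mem_of_mem_nhds hU
      simp [Measure.dirac_apply_of_mem hx, hp]
  rw [twoAtom, Measure.support_add, h p a hp, h q b hq]
  rfl

lemma integral_twoAtom {E : Type*} [NormedAddCommGroup E] [NormedSpace ℝ E] [CompleteSpace E]
    (hp : 0 ≤ p) (hq : 0 ≤ q) (φ : ℝ → E) :
    ∫ t, φ t ∂(twoAtom p q a b) = p • φ a + q • φ b := by
  have h : ∀ p a : ℝ, Integrable φ (ENNReal.ofReal p • Measure.dirac a) := fun p a =>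
    (integrable_dirac (by simp)).smul_measure ENNReal.ofReal_ne_top
  rw [twoAtom, integral_add_measure (h p a) (h q b), integral_smul_measure, integral_smul_measure,
    integral_dirac, integral_dirac, ENNReal.toReal_ofReal hp, ENNReal.toReal_ofReal hq]

/-- This equation does not involve `c`, so the substitution here is `r = 1 / x`; in the coordinate
of `u` the same `ρ` is the point `x* / c`. The value `x = 0` is no root, as the integral is then
positive. -/
lemma isCriticalRoot_twoAtom_iff (hp : 0 < p) (hq : 0 < q) (ha : 0 < a) {ρ : ℝ} (hρ : ρ ≠ 0)
    (hρa : ρ + a ≠ 0) (hρb : ρ + b ≠ 0)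
    (h : ∀ r : ℝ, r + a ≠ 0 → r + b ≠ 0 →
      (p * a ^ 2 / (r + a) ^ 3 + q * b ^ 2 / (r + b) ^ 3 = 0 ↔ r = ρ)) (x : ℝ) :
    IsCriticalRoot (twoAtom p q a b) x ↔ x = ρ⁻¹ := by
  rw [IsCriticalRoot, support_twoAtom hp hq, integral_twoAtom hp.le hq.le]
  simp only [mem_insert_iff, mem_singleton_iff, forall_eq_or_imp, forall_eq, smul_eq_mul]
  rcases eq_or_ne x 0 with rfl | hx
  · have : 0 < p * a ^ 2 + q * b ^ 2 := by positivity
    simp [this.ne', hρ.symm]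
  have hadd : ∀ t : ℝ, 1 + t * x = (x⁻¹ + t) * x := fun t => by field_simp
  have hne : ∀ t : ℝ, 1 + t * x ≠ 0 ↔ x⁻¹ + t ≠ 0 := fun t => by
    rw [hadd, mul_ne_zero_iff, and_iff_left hx]
  rw [hne, hne]
  have hsum : p * (a ^ 2 / (1 + a * x) ^ 3) + q * (b ^ 2 / (1 + b * x) ^ 3) =
      (p * a ^ 2 / (x⁻¹ + a) ^ 3 + q * b ^ 2 / (x⁻¹ + b) ^ 3) * (x⁻¹) ^ 3 := by
    rw [hadd, hadd]
    simp only [div_eq_mul_inv, mul_inv, mul_pow, inv_pow]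
    ring
  rw [hsum, mul_eq_zero, or_iff_left (pow_ne_zero 3 (inv_ne_zero hx))]
  constructor
  · rintro ⟨⟨h1, h2⟩, h3⟩
    rw [← (h _ h1 h2).1 h3, inv_inv]
  · rintro rfl
    rw [inv_inv]
    exact ⟨⟨hρa, hρb⟩, (h _ hρa hρb).2 rfl⟩

lemma criticalRatio_twoAtom (hp : 0 < p) (hq : 0 < q) {ρ : ℝ} (hρ : ρ ≠ 0) :
    criticalRatio (twoAtom p q a b) ρ⁻¹ = ratioSum p q a b ρ := by
  rw [criticalRatio, integral_twoAtom hp.le hq.le, ratioSum]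
  have h : ∀ t : ℝ, (t * ρ⁻¹) ^ 2 / (1 + t * ρ⁻¹) ^ 2 = (t / (ρ + t)) ^ 2 := by
    intro t
    have : 1 + t * ρ⁻¹ = (ρ + t) * ρ⁻¹ := by field_simp
    rw [this, ← div_pow, mul_div_mul_right _ _ (inv_ne_zero hρ)]
  simp only [h, smul_eq_mul]

lemma one_add_mul_inv (hc : c ≠ 0) {r : ℝ} (hr : r ≠ 0) (t : ℝ) :
    1 + c * t * (c * r)⁻¹ = (r + t) / r := by
  field_simp

lemma u_twoAtom (hc : 0 < c) (hp : 0 < p) (hq : 0 < q) {r : ℝ} (hr : r ≠ 0) :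
    u c (twoAtom p q a b) (c * r)⁻¹ = uInv c p q a b r := by
  rw [u, integral_twoAtom hp.le hq.le, uInv]
  simp only [one_add_mul_inv hc.ne' hr, smul_eq_mul, div_div_eq_mul_div, div_inv_eq_mul]
  ring

/-- The point `r = 0` corresponds to no finite `x`. In the theorem it lies in the level set only for
`c = 1`, and then one edge is missing from `u(Z)`. -/
lemma criticalPoints_twoAtom (hc : 0 < c) (hp : 0 < p) (hq : 0 < q) :
    criticalPoints c (twoAtom p q a b) =
      (fun r => (c * r)⁻¹) '' (levelSet c p q a b \ {0}) := by
  have key : ∀ r : ℝ, r ≠ 0 → ((c * r)⁻¹ ∈ criticalPoints c (twoAtom p q a b) ↔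
      r ∈ levelSet c p q a b) := by
    intro r hr
    have h : ∀ t : ℝ, c * t * (c * r)⁻¹ / ((r + t) / r) = t / (r + t) := by
      intro t
      field_simp
    have hne : ∀ t : ℝ, (r + t) / r ≠ 0 ↔ r + t ≠ 0 := by
      intro t
      rw [div_ne_zero_iff, and_iff_left hr]
    simp only [criticalPoints, uDomain, mem_ofPred_eq, support_twoAtom hp hq,
      integral_twoAtom hp.le hq.le, mem_insert_iff, mem_singleton_iff, forall_eq_or_imp, forall_eq,
      smul_eq_mul, one_add_mul_inv hc.ne' hr, h, hne, levelSet, ratioSum, sub_eq_zero, ne_eq,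
      inv_eq_zero, mul_eq_zero, hc.ne', hr, or_self, not_false_eq_true, true_and, and_assoc,
      eq_comm (a := c)]
  ext x
  constructor
  · intro hx
    have hx0 : x ≠ 0 := hx.1.1
    have e : (c * (c * x)⁻¹)⁻¹ = x := by
      have := hc.ne'
      field_simp
    have h0 : (c * x)⁻¹ ≠ 0 := inv_ne_zero (mul_ne_zero hc.ne' hx0)
    exact ⟨(c * x)⁻¹, ⟨(key _ h0).1 (by rwa [e]), h0⟩, e⟩
  · rintro ⟨r, ⟨hr, hr0⟩, rfl⟩
    exact (key r hr0).2 hr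

lemma image_u_criticalPoints (hc : 0 < c) (hp : 0 < p) (hq : 0 < q) :
    u c (twoAtom p q a b) '' criticalPoints c (twoAtom p q a b) =
      uInv c p q a b '' (levelSet c p q a b \ {0}) := by
  rw [criticalPoints_twoAtom hc hp hq, image_image]
  exact image_congr fun r hr => u_twoAtom hc hp hq hr.2

lemma image_u_criticalPoints_diff (hc : 0 < c) (hp : 0 < p) (hq : 0 < q) (ρ : ℝ) :
    u c (twoAtom p q a b) '' (criticalPoints c (twoAtom p q a b) \ {ρ⁻¹ / c}) =
      uInv c p q a b '' ((levelSet c p q a b \ {ρ}) \ {0}) := by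
  have hinj : Function.Injective fun r : ℝ => (c * r)⁻¹ :=
    inv_injective.comp (mul_right_injective₀ hc.ne')
  have e : ({ρ⁻¹ / c} : Set ℝ) = (fun r => (c * r)⁻¹) '' {ρ} := by
    rw [image_singleton, mul_inv, div_eq_mul_inv, mul_comm]
  rw [criticalPoints_twoAtom hc hp hq, e, ← image_sdiff hinj, image_image, sdiff_sdiff_comm]
  exact image_congr fun r hr => u_twoAtom hc hp hq hr.2

end TwoAtom

/-! ### Stieltjes transforms and the support of a measure -/

section Stieltjes

variable {F : Measure ℝ}

lemma im_one_div_sub (x : ℝ) (z : ℂ) :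
    (1 / ((x : ℂ) - z)).im = z.im / ((x - z.re) ^ 2 + z.im ^ 2) := by
  rw [one_div, Complex.inv_im]
  simp [Complex.normSq_apply, sq]

lemma norm_one_div_sub_le {δ : ℝ} (hδ : 0 < δ) {x : ℝ} {z : ℂ} (h : δ ≤ ‖(x : ℂ) - z‖) :
    ‖1 / ((x : ℂ) - z)‖ ≤ 1 / δ := by
  rw [norm_div, norm_one]
  exact one_div_le_one_div_of_le hδ h

lemma im_le_norm_sub (x : ℝ) (z : ℂ) : z.im ≤ ‖(x : ℂ) - z‖ := by
  have := Complex.abs_im_le_norm ((x : ℂ) - z)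
  simp only [Complex.sub_im, Complex.ofReal_im, zero_sub, abs_neg] at this
  exact (le_abs_self _).trans this

lemma abs_sub_re_le_norm_sub (x : ℝ) (z : ℂ) : |x - z.re| ≤ ‖(x : ℂ) - z‖ := by
  have := Complex.abs_re_le_norm ((x : ℂ) - z)
  simpa using this

lemma integrable_one_div_sub [IsFiniteMeasure F] {z : ℂ} (hz : 0 < z.im) :
    Integrable (fun x : ℝ => 1 / ((x : ℂ) - z)) F := by
  refine Integrable.of_bound (C := 1 / z.im) ?_
    (Eventually.of_forall fun x => norm_one_div_sub_le hz (im_le_norm_sub x z))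
  exact Measurable.aestronglyMeasurable (by fun_prop)

lemma integrable_im_one_div_sub [IsFiniteMeasure F] {z : ℂ} (hz : 0 < z.im) :
    Integrable (fun x : ℝ => z.im / ((x - z.re) ^ 2 + z.im ^ 2)) F :=
  (integrable_one_div_sub hz).im.congr (Eventually.of_forall fun x => im_one_div_sub x z)

lemma im_stieltjes [IsFiniteMeasure F] {z : ℂ} (hz : 0 < z.im) :
    (stieltjes F z).im = ∫ x, z.im / ((x - z.re) ^ 2 + z.im ^ 2) ∂F := by
  rw [stieltjes]
  refine (integral_im (integrable_one_div_sub hz)).symm.trans ?_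
  exact integral_congr_ae (Eventually.of_forall fun x => im_one_div_sub x z)

lemma im_stieltjes_pos [IsProbabilityMeasure F] {z : ℂ} (hz : 0 < z.im) :
    0 < (stieltjes F z).im := by
  have hpos : ∀ x : ℝ, 0 < z.im / ((x - z.re) ^ 2 + z.im ^ 2) := fun x => by positivity
  rw [im_stieltjes hz, integral_pos_iff_support_of_nonneg (fun x => (hpos x).le)
    (integrable_im_one_div_sub hz)]
  have : Function.support (fun x : ℝ => z.im / ((x - z.re) ^ 2 + z.im ^ 2)) = univ :=
    eq_univ_of_forall fun x => (hpos x).ne'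
  rw [this]
  simp

/-- On the ball of radius `η = Im z` about `Re z` the Poisson kernel is at least `1 / (2 η)`. -/
lemma measureReal_closedBall_le [IsFiniteMeasure F] {z : ℂ} (hz : 0 < z.im) :
    F.real (Metric.closedBall z.re z.im) ≤ 2 * z.im * (stieltjes F z).im := by
  have h : F.real (Metric.closedBall z.re z.im) * (1 / (2 * z.im)) ≤ (stieltjes F z).im := by
    rw [im_stieltjes hz, ← smul_eq_mul, ← integral_indicator_const _ measurableSet_closedBall]
    refine integral_mono ((integrable_const _).indicator measurableSet_closedBall)
      (integrable_im_one_div_sub hz) fun x => ?_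
    by_cases hx : x ∈ Metric.closedBall z.re z.im
    swap
    · rw [indicator_of_notMem hx]
      positivity
    rw [indicator_of_mem hx]
    rw [Metric.mem_closedBall, Real.dist_eq] at hx
    have : (x - z.re) ^ 2 ≤ z.im ^ 2 := by
      rw [← sq_abs]
      gcongr
    rw [div_le_div_iff₀ (by positivity) (by positivity)]
    nlinarith
  rw [mul_one_div, div_le_iff₀ (by positivity)] at h
  linarith

lemma ae_dist_ge {s δ : ℝ} (hF : F (Metric.ball s δ) = 0) : ∀ᵐ x ∂F, δ ≤ |x - s| := by
  refine measure_mono_null (fun x hx => ?_) hF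
  simpa [Metric.mem_ball, Real.dist_eq] using hx

lemma norm_stieltjes_le [IsProbabilityMeasure F] {δ : ℝ} (hδ : 0 < δ) {z : ℂ}
    (hF : F (Metric.ball z.re δ) = 0) : ‖stieltjes F z‖ ≤ 1 / δ := by
  have := norm_integral_le_of_norm_le_const (μ := F) (f := fun x : ℝ => 1 / ((x : ℂ) - z))
    (C := 1 / δ) ((ae_dist_ge hF).mono fun x hx =>
      norm_one_div_sub_le hδ (hx.trans (abs_sub_re_le_norm_sub x z)))
  simpa [stieltjes] using this

lemma im_stieltjes_le [IsProbabilityMeasure F] {δ : ℝ} (hδ : 0 < δ) {z : ℂ} (hz : 0 < z.im)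
    (hF : F (Metric.ball z.re δ) = 0) : (stieltjes F z).im ≤ z.im / δ ^ 2 := by
  rw [im_stieltjes hz]
  have h := integral_mono_ae (integrable_im_one_div_sub hz) (integrable_const (z.im / δ ^ 2))
    ((ae_dist_ge hF).mono fun x hx => ?_)
  · simpa using h
  · have : δ ^ 2 ≤ (x - z.re) ^ 2 := by
      rw [← sq_abs (x - z.re)]
      gcongr
    have := sq_nonneg z.im
    exact div_le_div_of_nonneg_left hz.le (by positivity) (by linarith)

/-- A quadratic bound for the mass of small balls makes the distribution function flat. -/
lemma hasDerivAt_measureReal_Iic [IsFiniteMeasure F] {s K δ : ℝ} (hδ : 0 < δ)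
    (h : ∀ η ∈ Ioo 0 δ, F.real (Metric.closedBall s η) ≤ K * η ^ 2) :
    HasDerivAt (fun y => F.real (Iic y)) 0 s := by
  have hdiff : ∀ x y : ℝ, x ≤ y → F.real (Iic y) - F.real (Iic x) = F.real (Ioc x y) := by
    intro x y hxy
    rw [← Iic_sdiff_Iic, measureReal_sdiff (Iic_subset_Iic.2 hxy) measurableSet_Iic]
  have hbound : ∀ y, dist y s < δ → |F.real (Iic y) - F.real (Iic s)| ≤ K * ‖y - s‖ ^ 2 := by
    intro y hy
    rw [Real.dist_eq] at hy
    rcases lt_trichotomy y s with hlt | rfl | hlt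
    · have hη : |y - s| = s - y := by rw [abs_sub_comm, abs_of_pos (by linarith)]
      rw [abs_sub_comm, hdiff y s hlt.le, abs_of_nonneg measureReal_nonneg, Real.norm_eq_abs]
      refine (measureReal_mono fun x hx => ?_).trans (h _ ⟨by rw [hη]; linarith, hy⟩)
      rw [Metric.mem_closedBall, Real.dist_eq, hη, abs_le]
      exact ⟨by linarith [hx.1], by linarith [hx.2]⟩
    · simp
    · have hη : |y - s| = y - s := abs_of_pos (by linarith)
      rw [hdiff s y hlt.le, abs_of_nonneg measureReal_nonneg, Real.norm_eq_abs]
      refine (measureReal_mono fun x hx => ?_).trans (h _ ⟨by rw [hη]; linarith, hy⟩)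
      rw [Metric.mem_closedBall, Real.dist_eq, hη, abs_le]
      exact ⟨by linarith [hx.1], by linarith [hx.2]⟩
  have hO : (fun y => F.real (Iic y) - F.real (Iic s)) =O[𝓝 s] fun y => ‖y - s‖ ^ 2 := by
    refine Asymptotics.IsBigO.of_bound K ?_
    filter_upwards [Metric.ball_mem_nhds s hδ] with y hy
    rw [Real.norm_eq_abs, norm_pow, norm_norm]
    exact hbound y hy
  have hd := (hO.hasFDerivAt (𝕜 := ℝ) (by norm_num)).hasDerivAt.add_const (F.real (Iic s))
  simpa using hd

/-- A distribution function with zero derivative throughout a neighbourhood is constant there, so a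
small interval around `s` has no mass. -/
lemma notMem_support_of_forall_hasDerivAt [IsFiniteMeasure F] {V : Set ℝ} {s : ℝ} (hV : V ∈ 𝓝 s)
    (h : ∀ y ∈ V, HasDerivAt (fun y => F.real (Iic y)) 0 y) : s ∉ F.support := by
  obtain ⟨ε, hε, hball⟩ := Metric.mem_nhds_iff.1 hV
  have hmem : ∀ y : ℝ, |y - s| < ε → y ∈ Metric.ball s ε := fun y hy => by
    rwa [Metric.mem_ball, Real.dist_eq]
  have hconst : F.real (Iic (s - ε / 2)) = F.real (Iic (s + ε / 2)) :=
    Metric.isOpen_ball.is_const_of_deriv_eq_zero (convex_ball s ε).isPreconnected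
      (fun y hy => (h y (hball hy)).differentiableAt.differentiableWithinAt)
      (fun y hy => (h y (hball hy)).deriv)
      (hmem _ (by rw [abs_lt]; constructor <;> linarith))
      (hmem _ (by rw [abs_lt]; constructor <;> linarith))
  rw [Measure.notMem_support_iff_exists]
  refine ⟨Ioc (s - ε / 2) (s + ε / 2), Ioc_mem_nhds (by linarith) (by linarith), ?_⟩
  rw [← measureReal_eq_zero_iff, ← Iic_sdiff_Iic,
    measureReal_sdiff (Iic_subset_Iic.2 (by linarith)) measurableSet_Iic, hconst, sub_self]

end Stieltjes

/-! ### Subcritical values lie off the support -/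

section Complex

variable {c p q a b : ℝ}

/-- Write `t ρ / (ρ + t) = t - t² / (ρ + t)`. -/
lemma im_mul_div_add {ρ : ℂ} {t : ℝ} (h : ρ + t ≠ 0) :
    ((t : ℂ) * ρ / (ρ + t)).im = ρ.im * ‖(t : ℂ) / (ρ + t)‖ ^ 2 := by
  have hn : Complex.normSq (ρ + t) ≠ 0 := by rwa [Ne, Complex.normSq_eq_zero]
  rw [Complex.sq_norm, map_div₀, Complex.div_im, Complex.normSq_ofReal]
  field_simp
  simp
  ring

lemma add_ofReal_ne_zero {ρ : ℂ} (h : ρ.im ≠ 0) (t : ℝ) : ρ + t ≠ 0 := by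
  intro h'
  apply h
  simpa using congrArg Complex.im h'

/-- The equation of the Stieltjes transform in the coordinate `ρ = 1 / (c m)`. -/
lemma IsLSD.equation_inv {F : Measure ℝ} (hF : IsLSD c (twoAtom p q a b) F) (hc : 0 < c)
    (hp : 0 < p) (hq : 0 < q) {z : ℂ} (hz : 0 < z.im) {ρ : ℂ}
    (hρ : ρ = ((c : ℂ) * stieltjes F z)⁻¹) :
    ρ.im < 0 ∧ stieltjes F z = ((c : ℂ) * ρ)⁻¹ ∧
    (stieltjes F z).im = -ρ.im / (c * ‖ρ‖ ^ 2) ∧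
    z = -c * ρ + (p * (a * ρ / (ρ + a)) + q * (b * ρ / (ρ + b))) ∧
    z.im = -ρ.im * (c - (p * ‖(a : ℂ) / (ρ + a)‖ ^ 2 + q * ‖(b : ℂ) / (ρ + b)‖ ^ 2)) := by
  have := hF.isProbabilityMeasure
  have hm := im_stieltjes_pos (F := F) hz
  have heq := hF.equation z hz
  set m := stieltjes F z
  have hm0 : m ≠ 0 := by
    intro h
    simp [h] at hm
  have hc0 : (c : ℂ) ≠ 0 := by exact_mod_cast hc.ne'
  have hρ0 : ρ ≠ 0 := hρ ▸ inv_ne_zero (mul_ne_zero hc0 hm0)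
  have hmρ : m = ((c : ℂ) * ρ)⁻¹ := by
    rw [hρ]
    field_simp
  have hmim : m.im = -ρ.im / (c * ‖ρ‖ ^ 2) := by
    rw [hmρ, Complex.inv_im, Complex.normSq_eq_norm_sq, norm_mul, Complex.norm_real,
      Real.norm_of_nonneg hc.le, Complex.im_ofReal_mul]
    field_simp
  have hρim : ρ.im < 0 := by
    have h2 : 0 < c * ‖ρ‖ ^ 2 := by positivity
    rw [hmim, lt_div_iff₀ h2] at hm
    linarith
  have hne := add_ofReal_ne_zero hρim.ne
  have hzρ : z = -c * ρ + (p * (a * ρ / (ρ + a)) + q * (b * ρ / (ρ + b))) := by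
    rw [integral_twoAtom hp.le hq.le] at heq
    have h1 : ∀ t : ℝ, (t : ℂ) / (1 + c * t * m) = t * ρ / (ρ + t) := by
      intro t
      have : 1 + c * t * m = (ρ + t) / ρ := by
        rw [hmρ]
        field_simp
      rw [this, div_div_eq_mul_div]
    rw [h1, h1, Complex.real_smul, Complex.real_smul] at heq
    rw [heq, hmρ, div_inv_eq_mul]
    ring
  refine ⟨hρim, hmρ, hmim, hzρ, ?_⟩
  conv_lhs => rw [hzρ]
  have h1 : ∀ (s : ℝ) (w : ℂ), ((s : ℂ) * w).im = s * w.im := fun s w => by simp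
  rw [Complex.add_im, Complex.add_im, ← Complex.ofReal_neg, h1, h1, h1, im_mul_div_add (hne a),
    im_mul_div_add (hne b)]
  ring

lemma IsLSD.measureReal_closedBall_le {F : Measure ℝ} (hF : IsLSD c (twoAtom p q a b) F)
    (hc : 0 < c) (hp : 0 < p) (hq : 0 < q) {r : ℝ} (hr : r ≠ 0)
    (hrc : r ∈ subcritical c p q a b) :
    ∃ K δ : ℝ, 0 < δ ∧ ∀ η ∈ Ioo 0 δ,
      F.real (Metric.closedBall (uInv c p q a b r) η) ≤ K * η ^ 2 := by
  have := hF.isProbabilityMeasure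
  obtain ⟨hra, hrb, hg⟩ := hrc
  set κ := (c - ratioSum p q a b r) / 2 with hκdef
  have hκ : 0 < κ := by
    rw [hκdef]
    linarith
  have hr' : 0 < |r| := abs_pos.2 hr
  -- The choice of `δ` gives `‖r - ρ‖ ≤ η / κ < |r| / 2`, hence `‖ρ‖ ≥ |r| / 2`. The constant is
  -- that of `2 η · (η / κ) / (c (|r| / 2)²)`.
  refine ⟨8 / (κ * c * r ^ 2), κ * |r| / 2, by positivity, fun η hη => ?_⟩
  obtain ⟨hη0, hη1⟩ := hη
  set z : ℂ := ⟨uInv c p q a b r, η⟩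
  have hz : 0 < z.im := hη0
  obtain ⟨hρim, -, hmim, hzρ, hzim⟩ := hF.equation_inv hc hp hq hz rfl
  set ρ := ((c : ℂ) * stieltjes F z)⁻¹
  have hne := add_ofReal_ne_zero hρim.ne
  set w : ℝ → ℂ := fun t => (t : ℂ) / (ρ + t) with hw
  -- Positivity of `Im z` makes `ρ` subcritical in modulus.
  have hG : p * ‖w a‖ ^ 2 + q * ‖w b‖ ^ 2 < c := by
    rw [hzim] at hz
    have := (pos_iff_pos_of_mul_pos hz).1 (by linarith)
    linarith
  set S : ℂ := p * ((a / (r + a) : ℝ) * w a) + q * ((b / (r + b) : ℝ) * w b) with hS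
  -- The mixed form is at most the mean of `ratioSum r = c - 2κ` and a quantity below `c`. So the
  -- factor `c - S` below has modulus at least `κ`.
  have hSle : ‖S‖ ≤ c - κ := by
    have h1 : ∀ (p x : ℝ) (y : ℂ), 0 < p →
        ‖(p : ℂ) * ((x : ℂ) * y)‖ ≤ p * ((x ^ 2 + ‖y‖ ^ 2) / 2) := by
      intro p x y hp
      rw [norm_mul, norm_mul, Complex.norm_real, Complex.norm_real, Real.norm_of_nonneg hp.le,
        Real.norm_eq_abs]
      gcongr
      nlinarith [sq_nonneg (|x| - ‖y‖), sq_abs x]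
    refine (norm_add_le _ _).trans ((add_le_add (h1 p _ _ hp) (h1 q _ _ hq)).trans ?_)
    rw [hκdef]
    have e : ratioSum p q a b r = p * (a / (r + a)) ^ 2 + q * (b / (r + b)) ^ 2 := rfl
    linarith
  have hdiff : z - (uInv c p q a b r : ℝ) = (r - ρ) * (c - S) := by
    have hra' : (r : ℂ) + a ≠ 0 := by exact_mod_cast hra
    have hrb' : (r : ℂ) + b ≠ 0 := by exact_mod_cast hrb
    have h1 := hne a
    have h2 := hne b
    rw [hzρ, uInv, hS]
    simp only [hw]
    push_cast
    field_simp
    ring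
  have hnorm : ‖z - (uInv c p q a b r : ℝ)‖ = η := by
    have : z - (uInv c p q a b r : ℝ) = (η : ℂ) * Complex.I := by
      apply Complex.ext <;> simp [z]
    rw [this, norm_mul, Complex.norm_I, mul_one, Complex.norm_real, Real.norm_of_nonneg hη0.le]
  have hρr : ‖(r : ℂ) - ρ‖ * κ ≤ η := by
    rw [← hnorm, hdiff, norm_mul]
    gcongr
    have h1 := norm_sub_norm_le (c : ℂ) S
    rw [Complex.norm_real, Real.norm_of_nonneg hc.le] at h1
    linarith
  have hρnorm : |r| / 2 ≤ ‖ρ‖ := by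
    have h1 : ‖(r : ℂ) - ρ‖ < |r| / 2 := by
      by_contra! h
      have := mul_le_mul_of_nonneg_right h hκ.le
      linarith
    have h2 := norm_sub_norm_le (r : ℂ) ρ
    rw [Complex.norm_real, Real.norm_eq_abs] at h2
    linarith
  have hρim' : -ρ.im ≤ η / κ := by
    rw [le_div_iff₀ hκ]
    refine le_trans ?_ hρr
    gcongr
    have := Complex.abs_im_le_norm ((r : ℂ) - ρ)
    simp only [Complex.sub_im, Complex.ofReal_im, zero_sub, abs_neg] at this
    exact (neg_le_abs _).trans this
  have hm : (stieltjes F z).im ≤ (η / κ) / (c * (|r| / 2) ^ 2) := by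
    rw [hmim]
    gcongr
  refine (ScaleMixture.measureReal_closedBall_le (F := F) (z := z) hη0).trans ?_
  calc 2 * z.im * (stieltjes F z).im ≤ 2 * η * ((η / κ) / (c * (|r| / 2) ^ 2)) := by gcongr
    _ = 8 / (κ * c * r ^ 2) * η ^ 2 := by
      rw [div_pow, sq_abs]
      field_simp
      ring

/-- Near `r`, `U` is continuous and strictly decreasing, so it maps a small interval onto a
neighbourhood of `U(r)`. The flatness of the distribution function is thus known on a whole
neighbourhood. -/
lemma image_uInv_mem_nhds (hp : 0 < p) (hq : 0 < q) (ha : 0 < a) {r : ℝ} (hr : r ≠ 0)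
    (hrc : r ∈ subcritical c p q a b) :
    uInv c p q a b '' (subcritical c p q a b \ {0}) ∈ 𝓝 (uInv c p q a b r) := by
  obtain ⟨hra, hrb, hg⟩ := hrc
  have hev : ∀ᶠ y in 𝓝 r, y ∈ subcritical c p q a b \ {0} := by
    have h1 : ContinuousAt (fun y : ℝ => y + a) r := by fun_prop
    have h2 : ContinuousAt (fun y : ℝ => y + b) r := by fun_prop
    filter_upwards [h1.eventually_ne hra, h2.eventually_ne hrb,
      (continuousAt_ratioSum hra hrb).eventually_lt_const hg, eventually_ne_nhds hr]
      with y h1 h2 h3 h4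
    exact ⟨⟨h1, h2, h3⟩, h4⟩
  obtain ⟨ε, hε, hball⟩ := Metric.mem_nhds_iff.1 hev
  have hsub : Icc (r - ε / 2) (r + ε / 2) ⊆ subcritical c p q a b \ {0} := fun y hy =>
    hball (by
      rw [Metric.mem_ball, Real.dist_eq, abs_lt]
      exact ⟨by linarith [hy.1], by linarith [hy.2]⟩)
  have hlt : ∀ x ∈ Icc (r - ε / 2) (r + ε / 2), ∀ y ∈ Icc (r - ε / 2) (r + ε / 2), x < y →
      uInv c p q a b y < uInv c p q a b x := fun x hx y hy hxy =>
    uInv_lt_uInv hp hq ha (hsub hx).1.1 (hsub hx).1.2.1 (hsub hy).1.1 (hsub hy).1.2.1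
      (hsub hx).1.2.2.le (hsub hy).1.2.2.le hxy
  have hle : r - ε / 2 ≤ r + ε / 2 := by linarith
  have hr_mem : r ∈ Icc (r - ε / 2) (r + ε / 2) := ⟨by linarith, by linarith⟩
  refine mem_of_superset (Icc_mem_nhds
    (hlt r hr_mem _ (right_mem_Icc.2 hle) (by linarith))
    (hlt _ (left_mem_Icc.2 hle) r hr_mem (by linarith))) ?_
  exact (intermediate_value_Icc' hle fun y hy =>
    (continuousAt_uInv (hsub hy).1.1 (hsub hy).1.2.1).continuousWithinAt).trans
    (image_mono hsub)

lemma IsLSD.notMem_support {F : Measure ℝ} (hF : IsLSD c (twoAtom p q a b) F)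
    (hc : 0 < c) (hp : 0 < p) (hq : 0 < q) (ha : 0 < a) {r : ℝ} (hr : r ≠ 0)
    (hrc : r ∈ subcritical c p q a b) : uInv c p q a b r ∉ F.support := by
  have := hF.isProbabilityMeasure
  refine notMem_support_of_forall_hasDerivAt (image_uInv_mem_nhds hp hq ha hr hrc) ?_
  rintro _ ⟨s, ⟨hs, hs0⟩, rfl⟩
  obtain ⟨K, δ, hδ, h⟩ := hF.measureReal_closedBall_le hc hp hq hs0 hs
  exact hasDerivAt_measureReal_Iic hδ h

end Complex

/-! ### Points off the support are subcritical values -/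

section Complex

variable {c p q a b : ℝ}

/-- A limit of solutions of the equation of the Stieltjes transform avoids `0` and the poles. -/
lemma polynomial_root_off_poles {s m c p q a b : ℂ} (hp : p ≠ 0) (hq : q ≠ 0)
    (ha : a ≠ 0) (hb : b ≠ 0) (hab : a ≠ b)
    (h : s * m * ((1 + c * a * m) * (1 + c * b * m)) + (1 + c * a * m) * (1 + c * b * m) -
      m * (p * a * (1 + c * b * m) + q * b * (1 + c * a * m)) = 0) :
    m ≠ 0 ∧ 1 + c * a * m ≠ 0 ∧ 1 + c * b * m ≠ 0 := by
  have hm : m ≠ 0 := by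
    rintro rfl
    simp at h
  have hboth : 1 + c * a * m = 0 → 1 + c * b * m = 0 → False := by
    intro h1 h2
    have h3 : c * m * (a - b) = 0 := by linear_combination h1 - h2
    rcases mul_eq_zero.1 h3 with h4 | h4
    · have : (1 : ℂ) = 0 := by linear_combination h1 - a * h4
      exact one_ne_zero this
    · exact hab (sub_eq_zero.1 h4)
  refine ⟨hm, fun h1 => hboth h1 ?_, fun h2 => hboth ?_ h2⟩
  -- Where one factor vanishes, a single term of the equation survives, and it forces the other
  -- factor to vanish too.
  · rw [h1] at h
    simpa [hm, hp, ha] using h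
  · rw [h2] at h
    simpa [hm, hq, hb] using h

/-- Around `s` there is a ball without mass, so `m` is bounded and `Im m = O(Im z)` on the vertical
line above `s`. A subsequence of `m` therefore has a real limit, which supplies `r`. -/
lemma IsLSD.exists_of_notMem_support {F : Measure ℝ} (hF : IsLSD c (twoAtom p q a b) F)
    (hc : 0 < c) (hp : 0 < p) (hq : 0 < q) (ha : 0 < a) (hab : a < b) {s : ℝ}
    (hs : s ∉ F.support) : ∃ r ∈ subcritical c p q a b \ {0}, uInv c p q a b r = s := by
  have := hF.isProbabilityMeasure
  have hb := ha.trans hab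
  obtain ⟨U, hU, hFU⟩ := Measure.notMem_support_iff_exists.1 hs
  obtain ⟨δ, hδ, hball⟩ := Metric.mem_nhds_iff.1 hU
  have hFδ : F (Metric.ball s δ) = 0 := measure_mono_null hball hFU
  set z : ℕ → ℂ := fun n => ⟨s, 1 / ((n : ℝ) + 1)⟩ with hzdef
  have hz : ∀ n, 0 < (z n).im := fun n => Nat.one_div_pos_of_nat
  have him0 : Tendsto (fun n => (z n).im) atTop (𝓝 0) := tendsto_one_div_add_atTop_nhds_zero_nat
  have hzlim : Tendsto z atTop (𝓝 (s : ℂ)) := by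
    have h1 : Tendsto (fun n => (s : ℂ) + ((z n).im : ℂ) * Complex.I) atTop
        (𝓝 ((s : ℂ) + ((0 : ℝ) : ℂ) * Complex.I)) :=
      (((Complex.continuous_ofReal.tendsto 0).comp him0).mul_const Complex.I).const_add (s : ℂ)
    have h2 : ∀ n, (s : ℂ) + ((z n).im : ℂ) * Complex.I = z n := fun n => Complex.re_add_im (z n)
    simpa [h2] using h1
  have hle : ∀ n, ‖stieltjes F (z n)‖ ≤ 1 / δ := fun n => norm_stieltjes_le hδ hFδ
  obtain ⟨M, -, k, hk, hM⟩ := tendsto_subseq_of_bounded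
    (Metric.isBounded_closedBall (x := (0 : ℂ)) (r := 1 / δ))
    (x := fun n => stieltjes F (z n)) (fun n => by simpa using hle n)
  simp only [Function.comp_def] at hM
  have hzk := hzlim.comp hk.tendsto_atTop
  have himk := him0.comp hk.tendsto_atTop
  simp only [Function.comp_def] at hzk himk
  have hMim : M.im = 0 := by
    have h1 := (Complex.continuous_im.tendsto M).comp hM
    refine tendsto_nhds_unique h1 (squeeze_zero (fun n => (im_stieltjes_pos (hz _)).le)
      (fun n => im_stieltjes_le hδ (hz (k n)) hFδ) ?_)
    simpa using himk.div_const (δ ^ 2)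
  -- With denominators cleared, the equation passes to the limit before the limit is known to avoid
  -- `0` and the poles.
  have hpoly : ∀ n, z n * stieltjes F (z n) *
      ((1 + c * a * stieltjes F (z n)) * (1 + c * b * stieltjes F (z n))) +
      (1 + c * a * stieltjes F (z n)) * (1 + c * b * stieltjes F (z n)) -
      stieltjes F (z n) * (p * a * (1 + c * b * stieltjes F (z n)) +
        q * b * (1 + c * a * stieltjes F (z n))) = 0 := by
    intro n
    obtain ⟨hρ, hm, -, hzρ, -⟩ := hF.equation_inv hc hp hq (hz n) rfl
    set ρ := ((c : ℂ) * stieltjes F (z n))⁻¹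
    have h1 := add_ofReal_ne_zero hρ.ne a
    have h2 := add_ofReal_ne_zero hρ.ne b
    have h3 : ρ ≠ 0 := by
      intro h
      simp [h] at hρ
    have h4 : (c : ℂ) ≠ 0 := by exact_mod_cast hc.ne'
    rw [hm]
    nth_rewrite 1 [hzρ]
    field_simp
    ring
  have hlim : (s : ℂ) * M * ((1 + c * a * M) * (1 + c * b * M)) +
      (1 + c * a * M) * (1 + c * b * M) -
      M * (p * a * (1 + c * b * M) + q * b * (1 + c * a * M)) = 0 := by
    have h1 : ∀ t : ℝ, Tendsto (fun n => 1 + (c : ℂ) * t * stieltjes F (z (k n))) atTop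
        (𝓝 (1 + c * t * M)) := fun t => (hM.const_mul _).const_add 1
    have h2 := (((hzk.mul hM).mul ((h1 a).mul (h1 b))).add ((h1 a).mul (h1 b))).sub
      (hM.mul (((h1 b).const_mul ((p : ℂ) * a)).add ((h1 a).const_mul ((q : ℂ) * b))))
    exact tendsto_nhds_unique h2 (by simp only [hpoly]; exact tendsto_const_nhds)
  obtain ⟨hM0, hMa, hMb⟩ := polynomial_root_off_poles (by exact_mod_cast hp.ne')
    (by exact_mod_cast hq.ne') (by exact_mod_cast ha.ne') (by exact_mod_cast hb.ne')
    (by exact_mod_cast hab.ne) hlim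
  obtain ⟨x, rfl⟩ : ∃ x : ℝ, M = x := ⟨M.re, Complex.ext rfl (by simpa using hMim)⟩
  have hx : x ≠ 0 := by exact_mod_cast hM0
  have hcx : c * x ≠ 0 := mul_ne_zero hc.ne' hx
  set r := (c * x)⁻¹ with hr
  have hadd : ∀ t : ℝ, r + t = (1 + c * t * x) * r := by
    intro t
    rw [hr]
    field_simp
  have hra : r + a ≠ 0 := by
    rw [hadd]
    exact mul_ne_zero (by exact_mod_cast hMa) (inv_ne_zero hcx)
  have hrb : r + b ≠ 0 := by
    rw [hadd]
    exact mul_ne_zero (by exact_mod_cast hMb) (inv_ne_zero hcx)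
  set ρ : ℕ → ℂ := fun n => ((c : ℂ) * stieltjes F (z (k n)))⁻¹ with hρdef
  have hρ : Tendsto ρ atTop (𝓝 (r : ℂ)) := by
    have h1 := (hM.const_mul (c : ℂ)).inv₀ (by exact_mod_cast hcx)
    rw [hr]
    push_cast
    exact h1
  have hw : ∀ t : ℝ, r + t ≠ 0 → Tendsto (fun n => (t : ℂ) / (ρ n + t)) atTop
      (𝓝 ((t / (r + t) : ℝ) : ℂ)) := by
    intro t ht
    push_cast
    exact tendsto_const_nhds.div (hρ.add_const _) (by exact_mod_cast ht)
  refine ⟨r, ⟨⟨hra, hrb, ?_⟩, inv_ne_zero hcx⟩, ?_⟩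
  · have hnorm : ∀ t : ℝ, r + t ≠ 0 → Tendsto (fun n => ‖(t : ℂ) / (ρ n + t)‖ ^ 2) atTop
        (𝓝 ((t / (r + t)) ^ 2)) := by
      intro t ht
      have := (hw t ht).norm.pow 2
      rwa [Complex.norm_real, Real.norm_eq_abs, sq_abs] at this
    have h1 : Tendsto (fun n => c - (p * ‖(a : ℂ) / (ρ n + a)‖ ^ 2 +
        q * ‖(b : ℂ) / (ρ n + b)‖ ^ 2)) atTop (𝓝 (c - ratioSum p q a b r)) :=
      (((hnorm a hra).const_mul p).add ((hnorm b hrb).const_mul q)).const_sub c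
    -- Dividing `Im m ≤ Im z / δ²` by `-Im ρ` bounds the bracket in the formula for `Im z` below by
    -- `δ² / (c ‖ρ‖²)`. This bound has a positive limit, so the inequality `ratioSum r < c` is
    -- strict.
    have h2 : Tendsto (fun n => δ ^ 2 / (c * ‖ρ n‖ ^ 2)) atTop (𝓝 (δ ^ 2 / (c * r ^ 2))) := by
      have h3 := ((hρ.norm.pow 2).const_mul c)
      rw [Complex.norm_real, Real.norm_eq_abs, sq_abs] at h3
      exact tendsto_const_nhds.div h3 (mul_ne_zero hc.ne' (pow_ne_zero 2 (inv_ne_zero hcx)))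
    have h3 : 0 < δ ^ 2 / (c * r ^ 2) := by
      have : r ≠ 0 := inv_ne_zero hcx
      positivity
    refine sub_pos.1 (h3.trans_le (le_of_tendsto_of_tendsto' h2 h1 fun n => ?_))
    obtain ⟨hρim, -, hmim, -, hzim⟩ := hF.equation_inv hc hp hq (hz (k n)) rfl
    have h4 := im_stieltjes_le hδ (hz (k n)) hFδ
    change (ρ n).im < 0 at hρim
    have hρ0 : ρ n ≠ 0 := by
      intro h
      simp [h] at hρim
    have hρn : 0 < ‖ρ n‖ := norm_pos_iff.2 hρ0
    rw [le_div_iff₀ (by positivity), hmim] at h4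
    refine le_of_mul_le_mul_left ?_ (neg_pos.2 hρim)
    calc -(ρ n).im * (δ ^ 2 / (c * ‖ρ n‖ ^ 2)) = -(ρ n).im / (c * ‖ρ n‖ ^ 2) * δ ^ 2 := by ring
      _ ≤ (z (k n)).im := h4
      _ = _ := hzim
  · have h1 : ∀ t : ℝ, r + t ≠ 0 → Tendsto (fun n => (t : ℂ) * ρ n / (ρ n + t)) atTop
        (𝓝 ((t * r / (r + t) : ℝ) : ℂ)) := by
      intro t ht
      push_cast
      exact (hρ.const_mul _).div (hρ.add_const _) (by exact_mod_cast ht)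
    have h2 := (hρ.const_mul (-(c : ℂ))).add
      (((h1 a hra).const_mul (p : ℂ)).add ((h1 b hrb).const_mul (q : ℂ)))
    have h3 : ∀ n, -(c : ℂ) * ρ n + (p * (a * ρ n / (ρ n + a)) + q * (b * ρ n / (ρ n + b))) =
        z (k n) := fun n => (hF.equation_inv hc hp hq (hz (k n)) rfl).2.2.2.1.symm
    simp only [h3] at h2
    have h4 := tendsto_nhds_unique h2 hzk
    rw [uInv]
    exact_mod_cast h4

/-- The support of the limiting spectral distribution is the complement of the image under `u` of
the points with `u' > 0`. -/
theorem IsLSD.compl_support {F : Measure ℝ} (hF : IsLSD c (twoAtom p q a b) F)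
    (hc : 0 < c) (hp : 0 < p) (hq : 0 < q) (ha : 0 < a) (hab : a < b) :
    F.supportᶜ = uInv c p q a b '' (subcritical c p q a b \ {0}) := by
  ext s
  constructor
  · exact hF.exists_of_notMem_support hc hp hq ha hab
  · rintro ⟨r, ⟨hr, hr0⟩, rfl⟩
    exact hF.notMem_support hc hp hq ha hr0 hr

/-- Admitting `r = 0` changes the image at most by the value `U(0) = 0`, which is removed on both
sides. -/
lemma IsLSD.support_sdiff_zero {F : Measure ℝ} (hF : IsLSD c (twoAtom p q a b) F)
    (hc : 0 < c) (hp : 0 < p) (hq : 0 < q) (ha : 0 < a) (hab : a < b) :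
    F.support \ {0} = (uInv c p q a b '' subcritical c p q a b)ᶜ \ {0} := by
  rw [← compl_compl F.support, hF.compl_support hc hp hq ha hab]
  ext s
  simp only [Set.mem_sdiff, mem_compl_iff, mem_image, mem_singleton_iff]
  refine and_congr_left fun hs => not_congr ⟨?_, ?_⟩
  · rintro ⟨r, ⟨hr, -⟩, rfl⟩
    exact ⟨r, hr, rfl⟩
  · rintro ⟨r, hr, rfl⟩
    exact ⟨r, ⟨hr, fun h => hs (by rw [h, uInv_zero])⟩, rfl⟩

end Complex

/-! ### Assembly of the theorem -/

lemma compl_Iio_union_Ioo_union_Ioi {s₁ s₂ s₃ s₄ : ℝ} (h₁₂ : s₁ < s₂) (h₂₃ : s₂ < s₃)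
    (h₃₄ : s₃ < s₄) : (Iio s₁ ∪ Ioo s₂ s₃ ∪ Ioi s₄)ᶜ = Icc s₁ s₂ ∪ Icc s₃ s₄ := by
  ext x
  simp only [mem_compl_iff, mem_union, mem_Iio, mem_Ioo, mem_Ioi, mem_Icc, not_or, not_lt, not_and]
  constructor
  · rintro ⟨⟨h1, h2⟩, h3⟩
    rcases le_or_gt x s₂ with h | h
    · exact Or.inl ⟨h1, h⟩
    · exact Or.inr ⟨h2 h, h3⟩
  · rintro (⟨h1, h2⟩ | ⟨h1, h2⟩)
    · exact ⟨⟨h1, fun h => by linarith⟩, by linarith⟩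
    · exact ⟨⟨by linarith, fun _ => h1⟩, h2⟩

lemma compl_Iio_union_Ioi {s₁ s₄ : ℝ} : (Iio s₁ ∪ Ioi s₄)ᶜ = Icc s₁ s₄ := by
  rw [compl_union, compl_Iio, compl_Ioi, Ici_inter_Iic]

lemma twoAtom_swap (p q a b : ℝ) : twoAtom p q a b = twoAtom q p b a := add_comm _ _

/-- The theorem for atoms `a < b`. -/
theorem support_structure {c p q a b : ℝ} (hc : 0 < c) (hp : 0 < p) (hq : 0 < q)
    (hpq : p + q = 1) (ha : 0 < a) (hab : a < b) (G : Measure ℝ) (hG : G = twoAtom p q a b) :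
    ∃ xstar : ℝ, (∀ x : ℝ, IsCriticalRoot G x ↔ x = xstar) ∧
      (criticalRatio G xstar < c →
        ∃ s₁ s₂ s₃ s₄ : ℝ, 0 ≤ s₁ ∧ s₁ < s₂ ∧ s₂ < s₃ ∧ s₃ < s₄ ∧ (s₁ = 0 ↔ c = 1) ∧
          (c ≠ 1 → u c G '' criticalPoints c G = {s₁, s₂, s₃, s₄}) ∧
          (c = 1 → u c G '' criticalPoints c G = {s₂, s₃, s₄}) ∧
          ∀ F : Measure ℝ, IsLSD c G F →
            F.support \ {0} = (Icc s₁ s₂ ∪ Icc s₃ s₄) \ {0}) ∧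
      (c ≤ criticalRatio G xstar →
        ∃ s₁ s₄ : ℝ, 0 ≤ s₁ ∧ s₁ < s₄ ∧ (s₁ = 0 ↔ c = 1) ∧
          (c ≠ 1 → u c G '' (criticalPoints c G \ {xstar / c}) = {s₁, s₄}) ∧
          (c = 1 → u c G '' (criticalPoints c G \ {xstar / c}) = {s₄}) ∧
          ∀ F : Measure ℝ, IsLSD c G F → F.support \ {0} = Icc s₁ s₄ \ {0}) := by
  subst hG
  obtain ⟨ρ, hρb, hρa, hroot, hanti, hmono⟩ := exists_middle_min hp hq ha hab
  have hρ : ρ ≠ 0 := by linarith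
  refine ⟨ρ⁻¹, isCriticalRoot_twoAtom_iff hp hq ha hρ (by linarith) (by linarith) hroot, ?_, ?_⟩
  · rw [criticalRatio_twoAtom hp hq hρ]
    intro hcρ
    obtain ⟨r₁, r₂, r₃, r₄, h₄₃, h₃₂, h₂₁, h₂, hr₁, hlev, hs₁, hs₁', h12, h23, h34, himg⟩ :=
      exists_four_edges hc hp hq hpq ha hab hρb hρa hanti hmono hcρ
    refine ⟨_, _, _, _, hs₁, h12, h23, h34, hs₁', fun hc1 => ?_, fun hc1 => ?_, fun F hF => ?_⟩
    · have : (0 : ℝ) ∉ levelSet c p q a b := by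
        rw [hlev]
        simp only [mem_insert_iff, mem_singleton_iff]
        rintro (h | h | h | h)
        · exact hc1 (hr₁.1 h.symm)
        all_goals linarith
      rw [image_u_criticalPoints hc hp hq, sdiff_singleton_eq_self this, hlev]
      simp only [image_insert_eq, image_singleton]
    -- For `c = 1` the edge `r₁ = 0` is the only one without a finite `x`; the others are negative.
    · have h0 := hr₁.2 hc1
      rw [image_u_criticalPoints hc hp hq, hlev, h0, insert_sdiff_self_of_notMem]
      · simp only [image_insert_eq, image_singleton]
      · simp only [mem_insert_iff, mem_singleton_iff]
        rintro (h | h | h) <;> linarith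
    · rw [hF.support_sdiff_zero hc hp hq ha hab, himg, compl_Iio_union_Ioo_union_Ioi h12 h23 h34]
  · rw [criticalRatio_twoAtom hp hq hρ]
    intro hcρ
    obtain ⟨r₁, r₄, h₄₁, h₄, hr₁, hlev, hs₁, hs₁', h14, himg⟩ :=
      exists_two_edges hc hp hq hpq ha hab hρb hρa hanti hmono hcρ
    refine ⟨_, _, hs₁, h14, hs₁', fun hc1 => ?_, fun hc1 => ?_, fun F hF => ?_⟩
    · have : (0 : ℝ) ∉ levelSet c p q a b \ {ρ} := by
        rw [hlev]
        simp only [mem_insert_iff, mem_singleton_iff]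
        rintro (h | h)
        · exact hc1 (hr₁.1 h.symm)
        · linarith
      rw [image_u_criticalPoints_diff hc hp hq, sdiff_singleton_eq_self this, hlev]
      simp only [image_insert_eq, image_singleton]
    · have h0 := hr₁.2 hc1
      rw [image_u_criticalPoints_diff hc hp hq, hlev, h0, insert_sdiff_self_of_notMem]
      · simp only [image_singleton]
      · intro h
        linarith [mem_singleton_iff.1 h]
    · rw [hF.support_sdiff_zero hc hp hq ha hab, himg, compl_Iio_union_Ioi]

end ScaleMixture

theorem mainTheorem10 (α₁ α₂ σ₁ σ₂ c : ℝ) (hα₁ : 0 < α₁) (hα₁' : α₁ < 1)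
    (hα : α₁ + α₂ = 1) (hσ₁ : 0 < σ₁) (hσ₂ : 0 < σ₂) (hσ : σ₁ ^ 2 ≠ σ₂ ^ 2) (hc : 0 < c)
    (G : Measure ℝ) (hG : G = ScaleMixture.twoAtom α₁ α₂ (σ₁ ^ 2) (σ₂ ^ 2)) :
    ∃ xstar : ℝ, (∀ x : ℝ, ScaleMixture.IsCriticalRoot G x ↔ x = xstar) ∧
      (ScaleMixture.criticalRatio G xstar < c →
        ∃ s₁ s₂ s₃ s₄ : ℝ, 0 ≤ s₁ ∧ s₁ < s₂ ∧ s₂ < s₃ ∧ s₃ < s₄ ∧ (s₁ = 0 ↔ c = 1) ∧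
          (c ≠ 1 → ScaleMixture.u c G '' ScaleMixture.criticalPoints c G = {s₁, s₂, s₃, s₄}) ∧
          (c = 1 → ScaleMixture.u c G '' ScaleMixture.criticalPoints c G = {s₂, s₃, s₄}) ∧
          ∀ F : Measure ℝ, ScaleMixture.IsLSD c G F →
            F.support \ {0} = (Set.Icc s₁ s₂ ∪ Set.Icc s₃ s₄) \ {0}) ∧
      (c ≤ ScaleMixture.criticalRatio G xstar →
        ∃ s₁ s₄ : ℝ, 0 ≤ s₁ ∧ s₁ < s₄ ∧ (s₁ = 0 ↔ c = 1) ∧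
          (c ≠ 1 → ScaleMixture.u c G '' (ScaleMixture.criticalPoints c G \ {xstar / c})
            = {s₁, s₄}) ∧
          (c = 1 → ScaleMixture.u c G '' (ScaleMixture.criticalPoints c G \ {xstar / c})
            = {s₄}) ∧
          ∀ F : Measure ℝ, ScaleMixture.IsLSD c G F →
            F.support \ {0} = Set.Icc s₁ s₄ \ {0}) := by
  have hα₂ : 0 < α₂ := by linarith
  rcases lt_or_gt_of_ne hσ with h | h
  · exact ScaleMixture.support_structure hc hα₁ hα₂ hα (by positivity) h G hG
  · exact ScaleMixture.support_structure hc hα₂ hα₁ (by linarith) (by positivity) h G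
      (hG.trans (ScaleMixture.twoAtom_swap _ _ _ _))
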